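/- Let $S^{N-1}(\sqrt N)\subset\mathbb R^N$ be the sphere of radius $\sqrt N$ with its uniform probability measure $\sigma^N$, and let $L_N=N(Q_N-I)$ be the generator of the Kac master equation, where $$Q_N\varphi(V)=\binom N2^{-1}\sum_{i<j}\frac1{2\pi}\int_0^{2\pi}\varphi(R_{i,j,\theta}V)\,d\theta$$ and $R_{i,j,\theta}$ replaces $(v_i,v_j)$ by $(\cos\theta\,v_i-\sin\theta\,v_j,\ \sin\theta\,v_i+\cos\theta\,v_j)$ and fixes the other coordinates. For a probability density $F$ with respect to $\sigma^N$ put $H_N(F)=\int F\log F\,d\sigma^N\in[0,\infty]$ and $-\langle\log F,L_NF\rangle=-\int \log F\cdot L_NF\,d\sigma^N$; for $N\ge2$ and $H_N(F)<\infty$ the latter is well defined in $(-\infty,\infty]$, with value $+\infty$ if $F$ vanishes on a set of positive measure. Let $$\Gamma_N=\inf\Big\{\frac{-\langle\log F,L_NF\rangle}{H_N(F)}:\ F \text{ a probability density on } S^{N-1}(\sqrt N),\ 0<H_N(F)<\infty\Big\}.$$ A sequence of probability measures $\mu^{(N)}$ on $S^{N-1}(\sqrt N)$, $N\ge1$, is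 called $\mu$-chaotic, for a probability measure $\mu$ on $\mathbb R$, if each $\mu^{(N)}$ is invariant under permutations of the coordinates and, for each fixed $k\ge1$, the marginal of $\mu^{(N)}$ on $(v_1,\dots,v_k)$ converges weakly (against bounded continuous functions) to $\mu^{\otimes k}$ as $N\to\infty$. **Theorem.** For every $c>0$ there is a smooth bounded probability density $f$ on $\mathbb R$ with finite moments of all orders, $\int vf(v)\,dv=0$ and $\int v^2f(v)\,dv=1$, such that the conditioned tensor products $$F^N(v)=\frac{\prod_{j=1}^Nf(v_j)}{\int_{S^{N-1}(\sqrt N)}\prod_{j=1}^Nf(w_j)\,d\sigma^N(w)}\qquad(N\ge1)$$ are probability densities with respect to $\sigma^N$, the sequence $\{F^N\sigma^N\}_{N\ge1}$ is $f\,dv$-chaotic, $0<H_N(F^N)<\infty$ for all sufficiently large $N$, and $$\limsup_{N\to\infty}\frac{-\langle\log F^N,L_NF^N\rangle}{H_N(F^N)}\le c .$$ Consequently there is no $c>0$ such that $\Gamma_N\ge c$ for all (sufficiently large) $N$. -/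

import Mathlib

open MeasureTheory Filter Topology
open scoped ENNReal ContDiff BoundedContinuousFunction

noncomputable section

namespace KacModel

/-- The state space `S^{N-1}(√N)`, the sphere of radius `√N` in Euclidean space `ℝ^N`. -/
abbrev KacSphere (N : ℕ) : Type :=
  ↥(Metric.sphere (0 : EuclideanSpace ℝ (Fin N)) (√(N : ℝ)))

/-- The dilation from the unit sphere of `ℝ^N` onto `S^{N-1}(√N)`. -/
def dilate (N : ℕ) (v : ↥(Metric.sphere (0 : EuclideanSpace ℝ (Fin N)) 1)) : KacSphere N :=
  ⟨√(N : ℝ) • (v : EuclideanSpace ℝ (Fin N)), by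
    have hv := mem_sphere_zero_iff_norm.mp v.2
    rw [mem_sphere_zero_iff_norm, norm_smul, hv, mul_one, Real.norm_of_nonneg (Real.sqrt_nonneg _)]⟩

/-- The uniform probability measure `σ^N` on `S^{N-1}(√N)`: the normalized surface measure of the
unit sphere, transported by dilation. -/
def sigma (N : ℕ) : Measure (KacSphere N) :=
  Measure.map (dilate N)
    (((volume : Measure (EuclideanSpace ℝ (Fin N))).toSphere Set.univ)⁻¹ •
      (volume : Measure (EuclideanSpace ℝ (Fin N))).toSphere)

/-- The rotation `R_{i,j,θ}` of `ℝ^N` in the `(v_i, v_j)` plane,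
`(v_i, v_j) ↦ (cos θ v_i - sin θ v_j, sin θ v_i + cos θ v_j)`. -/
def rotVec {N : ℕ} (i j : Fin N) (θ : ℝ) (v : EuclideanSpace ℝ (Fin N)) :
    EuclideanSpace ℝ (Fin N) :=
  WithLp.toLp 2 fun k =>
    if k = i then Real.cos θ * v i - Real.sin θ * v j
    else if k = j then Real.sin θ * v i + Real.cos θ * v j
    else v k

theorem norm_rotVec {N : ℕ} {i j : Fin N} (hij : i ≠ j) (θ : ℝ) (v : EuclideanSpace ℝ (Fin N)) :
    ‖rotVec i j θ v‖ = ‖v‖ := by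
  rw [EuclideanSpace.norm_eq, EuclideanSpace.norm_eq]
  congr 1
  have hj : j ∈ Finset.univ.erase i := Finset.mem_erase.mpr ⟨hij.symm, Finset.mem_univ j⟩
  rw [← Finset.add_sum_erase _ _ (Finset.mem_univ i), ← Finset.add_sum_erase _ _ hj,
    ← Finset.add_sum_erase _ (fun k => ‖v k‖ ^ 2) (Finset.mem_univ i),
    ← Finset.add_sum_erase _ (fun k => ‖v k‖ ^ 2) hj, ← add_assoc, ← add_assoc]
  congr 1
  · simp only [rotVec, if_true, if_neg hij.symm, Real.norm_eq_abs, sq_abs]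
    nlinarith [Real.sin_sq_add_cos_sq θ]
  · refine Finset.sum_congr rfl fun k hk => ?_
    have h1 : k ≠ j := Finset.ne_of_mem_erase hk
    have h2 : k ≠ i := Finset.ne_of_mem_erase (Finset.mem_of_mem_erase hk)
    simp only [rotVec, if_neg h1, if_neg h2]

/-- The rotation `R_{i,j,θ}`, for `i < j`, as a map of `S^{N-1}(√N)` to itself. -/
def rot {N : ℕ} (p : {p : Fin N × Fin N // p.1 < p.2}) (θ : ℝ) (v : KacSphere N) : KacSphere N :=
  ⟨rotVec p.1.1 p.1.2 θ v, by
    rw [mem_sphere_zero_iff_norm, norm_rotVec p.2.ne]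
    exact mem_sphere_zero_iff_norm.mp v.2⟩

/-- The transition operator of the Kac walk,
`Q_N φ (V) = binom(N,2)⁻¹ ∑_{i<j} (2π)⁻¹ ∫_0^{2π} φ(R_{i,j,θ} V) dθ`. -/
def Q (N : ℕ) (φ : KacSphere N → ℝ) (v : KacSphere N) : ℝ :=
  ((N.choose 2 : ℕ) : ℝ)⁻¹ * ∑ p : {p : Fin N × Fin N // p.1 < p.2},
    (2 * Real.pi)⁻¹ * ∫ θ in (0 : ℝ)..(2 * Real.pi), φ (rot p θ v)

/-- The generator `L_N = N (Q_N - I)` of the Kac master equation. -/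
def L (N : ℕ) (φ : KacSphere N → ℝ) (v : KacSphere N) : ℝ :=
  (N : ℝ) * (Q N φ v - φ v)

/-- The measure `F σ^N`. -/
def densityMeasure (N : ℕ) (F : KacSphere N → ℝ) : Measure (KacSphere N) :=
  (sigma N).withDensity fun v => ENNReal.ofReal (F v)

/-- `F` is a probability density on `S^{N-1}(√N)` with respect to `σ^N`. -/
def IsProbDensity (N : ℕ) (F : KacSphere N → ℝ) : Prop :=
  Measurable F ∧ (∀ v, 0 ≤ F v) ∧ Integrable F (sigma N) ∧ ∫ v, F v ∂(sigma N) = 1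

/-- The relative entropy `H_N(F) = H(F σ^N | σ^N) ∈ [0, ∞]`. -/
def entropy (N : ℕ) (F : KacSphere N → ℝ) : ℝ≥0∞ :=
  InformationTheory.klDiv (densityMeasure N F) (sigma N)

open Classical in
/-- The entropy production `-⟨log F, L_N F⟩`, for a probability density `F` of finite entropy.
As `F log F` and the positive part of `(Q_N F) log F` are integrable for such `F`, the pairing has
a well-defined value in `(-∞, ∞]`. The value is `+∞` if `log F · L_N F` is not integrable. It is
also `+∞` if `F` vanishes on a set of positive measure, since `log F = -∞` there and (for `N ≥ 2`)
`L_N F = N Q_N F > 0` on a subset of positive measure. -/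
def entropyProduction (N : ℕ) (F : KacSphere N → ℝ) : EReal :=
  if (∀ᵐ v ∂(sigma N), 0 < F v) ∧ Integrable (fun v => Real.log (F v) * L N F v) (sigma N) then
    ((-∫ v, Real.log (F v) * L N F v ∂(sigma N) : ℝ) : EReal)
  else ⊤

/-- The ratio `-⟨log F, L_N F⟩ / H_N(F)` (meaningful when `0 < H_N(F) < ∞`). -/
def productionRatio (N : ℕ) (F : KacSphere N → ℝ) : EReal :=
  entropyProduction N F / ((entropy N F : ℝ≥0∞) : EReal)

/-- The entropy production constant `Γ_N`: the infimum of `-⟨log F, L_N F⟩ / H_N(F)` over all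
probability densities `F` with `H_N(F) < ∞` for which the ratio makes sense (`H_N(F) ≠ 0`). -/
def Gam (N : ℕ) : EReal :=
  sInf {x : EReal | ∃ F : KacSphere N → ℝ,
    IsProbDensity N F ∧ entropy N F ≠ 0 ∧ entropy N F ≠ ⊤ ∧ x = productionRatio N F}

/-- The action of a permutation of the coordinates on `S^{N-1}(√N)`. -/
def permute {N : ℕ} (π : Equiv.Perm (Fin N)) (v : KacSphere N) : KacSphere N :=
  ⟨LinearIsometryEquiv.piLpCongrLeft 2 ℝ ℝ π (v : EuclideanSpace ℝ (Fin N)), by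
    rw [mem_sphere_zero_iff_norm, LinearIsometryEquiv.norm_map]
    exact mem_sphere_zero_iff_norm.mp v.2⟩

/-- The first `k` coordinates of a point of `S^{N-1}(√N)`. Only `k ≤ N` is meaningful. -/
def firstCoords (k N : ℕ) (v : KacSphere N) : Fin k → ℝ := fun i =>
  if h : (i : ℕ) < N then (v : EuclideanSpace ℝ (Fin N)) ⟨i, h⟩ else 0

/-- Kac's chaos: a sequence of probability measures `M N` on `S^{N-1}(√N)`, `N ≥ 1`, is
`μ`-chaotic if each is symmetric under permutations of the coordinates, and for each fixed `k ≥ 1`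
the marginal on the first `k` coordinates converges weakly to `μ^{⊗k}`. -/
def IsChaotic (μ : Measure ℝ) (M : ∀ N : ℕ, Measure (KacSphere N)) : Prop :=
  (∀ N : ℕ, 1 ≤ N → IsProbabilityMeasure (M N)) ∧
  (∀ N : ℕ, 1 ≤ N → ∀ π : Equiv.Perm (Fin N), Measure.map (permute π) (M N) = M N) ∧
  ∀ k : ℕ, 1 ≤ k → ∀ χ : (Fin k → ℝ) →ᵇ ℝ,
    Tendsto (fun N : ℕ => ∫ v, χ (firstCoords k N v) ∂(M N)) atTop
      (𝓝 (∫ x, χ x ∂(Measure.pi fun _ : Fin k => μ)))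

/-- The measure `f(v) dv` on `ℝ`. -/
def lineMeasure (f : ℝ → ℝ) : Measure ℝ :=
  (volume : Measure ℝ).withDensity fun v => ENNReal.ofReal (f v)

/-- The normalization `Z_N(f, √N) = ∫ ∏_j f(v_j) dσ^N`. -/
def Z (N : ℕ) (f : ℝ → ℝ) : ℝ :=
  ∫ v : KacSphere N, ∏ j : Fin N, f ((v : EuclideanSpace ℝ (Fin N)) j) ∂(sigma N)

/-- The conditioned tensor product of `f`, as a density with respect to `σ^N`. -/
def condTensor (f : ℝ → ℝ) (N : ℕ) (v : KacSphere N) : ℝ :=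
  (∏ j : Fin N, f ((v : EuclideanSpace ℝ (Fin N)) j)) / Z N f

end KacModel

end

/-!
A tensor product conditioned to the sphere `S^{N-1}(√N)` is comparable with the free one: thickening
the sphere to a shell by dilation costs a factor `exp (o(N))` when `log f` is Lipschitz in `v ^ 2`.
Hoeffding's lemma over disjoint blocks of coordinates bounds exponential moments of empirical means
under the free law, hence under the conditioned law, where Jensen's inequality turns them into
bounds on expectations. This yields chaos and, since the energy is conserved, the convergence of
expectations of observables of quadratic growth. Per particle, the entropy of the conditioned law
then tends to the entropy of `f` relative to the standard Gaussian, and the entropy production tends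
to a two-particle integral.

It remains to choose `f`. Mix a cold Gaussian with a hot one of weight `δ` and variance
`1 / (2 * δ)`, so that each population carries half of the energy. Collisions within one population
produce no entropy and mixed collisions have frequency `O(δ)`, so the production is
`O(δ log (1 / δ))`, whereas the entropy stays near `(log 2) / 2` as `δ → 0`.
-/

noncomputable section

namespace KacModel

open scoped NNReal

section SphereMap

variable {E : Type*} [NormedAddCommGroup E] [NormedSpace ℝ E]

/-- The map of the sphere of radius `r` about the origin induced by a linear isometry. Both the
collisions `rot p θ` and the permutations of coordinates are of this form. -/
def sphereMap (T : E ≃ₗᵢ[ℝ] E) (r : ℝ) (v : Metric.sphere (0 : E) r) : Metric.sphere (0 : E) r :=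
  ⟨T v, by simp⟩

theorem continuous_sphereMap (T : E ≃ₗᵢ[ℝ] E) (r : ℝ) : Continuous (sphereMap T r) :=
  (T.continuous.comp continuous_subtype_val).subtype_mk _

open scoped Pointwise in
theorem preimage_smul_image_sphere (T : E ≃ₗᵢ[ℝ] E) (I : Set ℝ)
    (s : Set (Metric.sphere (0 : E) 1)) :
    T ⁻¹' (I • (Subtype.val '' s)) = I • (Subtype.val '' (sphereMap T 1 ⁻¹' s)) := by
  ext x
  simp only [Set.mem_smul, Set.mem_image, Set.mem_preimage]
  constructor
  · rintro ⟨r, hr, _, ⟨v, hv, rfl⟩, hx⟩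
    refine ⟨r, hr, T.symm v, ⟨sphereMap T.symm 1 v, ?_, rfl⟩, ?_⟩
    · simpa [sphereMap] using hv
    · rw [← map_smul, hx, T.symm_apply_apply]
  · rintro ⟨r, hr, _, ⟨v, hv, rfl⟩, rfl⟩
    exact ⟨r, hr, _, ⟨_, hv, rfl⟩, (T.map_smul _ _).symm⟩

theorem measurePreserving_sphereMap_toSphere [MeasurableSpace E] [BorelSpace E]
    {μ : Measure E} {T : E ≃ₗᵢ[ℝ] E} (hT : MeasurePreserving T μ μ) :
    MeasurePreserving (sphereMap T 1) μ.toSphere μ.toSphere := by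
  have hm : Measurable (sphereMap T 1) := (continuous_sphereMap T 1).measurable
  refine ⟨hm, Measure.ext fun s hs => ?_⟩
  rw [Measure.map_apply hm hs, Measure.toSphere_apply' _ hs, Measure.toSphere_apply' _ (hm hs),
    ← preimage_smul_image_sphere,
    hT.measure_preimage_emb T.toHomeomorph.measurableEmbedding]

end SphereMap

section UniformMeasure

variable {N : ℕ}

theorem continuous_dilate (N : ℕ) : Continuous (dilate N) :=
  Continuous.subtype_mk (by fun_prop) _

instance isFiniteMeasure_sigma (N : ℕ) : IsFiniteMeasure (sigma N) := by
  rcases subsingleton_or_nontrivial (EuclideanSpace ℝ (Fin N)) with h | h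
  · have : (volume : Measure (EuclideanSpace ℝ (Fin N))).toSphere = 0 :=
      (Measure.toSphere_eq_zero_iff _).mpr h
    rw [sigma, this, smul_zero, Measure.map_zero]
    infer_instance
  · have := Measure.smul_finite (volume : Measure (EuclideanSpace ℝ (Fin N))).toSphere
      (ENNReal.inv_ne_top.mpr (Measure.measure_univ_ne_zero.mpr
        (Measure.toSphere_ne_zero (volume : Measure (EuclideanSpace ℝ (Fin N))))))
    exact Measure.isFiniteMeasure_map _ _

instance isProbabilityMeasure_sigma [NeZero N] : IsProbabilityMeasure (sigma N) := by
  have h0 : (volume : Measure (EuclideanSpace ℝ (Fin N))).toSphere Set.univ ≠ 0 :=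
    Measure.measure_univ_ne_zero.mpr (Measure.toSphere_ne_zero _)
  have : IsProbabilityMeasure
      (((volume : Measure (EuclideanSpace ℝ (Fin N))).toSphere Set.univ)⁻¹ •
        (volume : Measure (EuclideanSpace ℝ (Fin N))).toSphere) :=
    ⟨by simpa using ENNReal.inv_mul_cancel h0 (measure_ne_top _ _)⟩
  exact Measure.isProbabilityMeasure_map (continuous_dilate N).measurable.aemeasurable

theorem integrable_of_continuous {φ : KacSphere N → ℝ} (hφ : Continuous φ) :
    Integrable φ (sigma N) :=
  hφ.integrable_of_hasCompactSupport (HasCompactSupport.of_compactSpace φ)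

theorem measurePreserving_sphereMap_sigma
    (T : EuclideanSpace ℝ (Fin N) ≃ₗᵢ[ℝ] EuclideanSpace ℝ (Fin N)) :
    MeasurePreserving (sphereMap T √(N : ℝ)) (sigma N) (sigma N) := by
  have hm := (continuous_sphereMap T √(N : ℝ)).measurable
  have hd := (continuous_dilate N).measurable
  have hT := measurePreserving_sphereMap_toSphere T.measurePreserving
  have hcomm : sphereMap T √(N : ℝ) ∘ dilate N = dilate N ∘ sphereMap T 1 := by
    ext v : 2
    simp [sphereMap, dilate]
  refine ⟨hm, ?_⟩
  rw [sigma, Measure.map_map hm hd, hcomm, ← Measure.map_map hd hT.measurable, Measure.map_smul,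
    hT.map_eq]

theorem norm_sq_eq (v : KacSphere N) : ‖v.1‖ ^ 2 = N := by
  rw [mem_sphere_zero_iff_norm.mp v.2, Real.sq_sqrt (Nat.cast_nonneg N)]

theorem sum_sq_eq (v : KacSphere N) : ∑ j, v.1 j ^ 2 = N :=
  (EuclideanSpace.real_norm_sq_eq v.1).symm.trans (norm_sq_eq v)

end UniformMeasure

section Polar

theorem lintegral_eq_lintegral_toSphere {E : Type*} [NormedAddCommGroup E] [NormedSpace ℝ E]
    [FiniteDimensional ℝ E] [Nontrivial E] [MeasurableSpace E] [BorelSpace E] (μ : Measure E)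
    [μ.IsAddHaarMeasure] {φ : E → ℝ≥0∞} (hφ : Measurable φ) :
    ∫⁻ x, φ x ∂μ = ∫⁻ r : Set.Ioi (0 : ℝ), ∫⁻ u : Metric.sphere (0 : E) 1, φ (r.1 • u.1)
      ∂μ.toSphere ∂(Measure.volumeIoiPow (Module.finrank ℝ E - 1)) := by
  have : SecondCountableTopology E := secondCountable_of_proper
  calc ∫⁻ x, φ x ∂μ = ∫⁻ x in {(0 : E)}ᶜ, φ x ∂μ := by rw [restrict_compl_singleton]
    _ = ∫⁻ x : ({(0 : E)}ᶜ : Set E), φ x ∂(μ.comap Subtype.val) := by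
        rw [lintegral_subtype_comap (measurableSet_singleton _).compl]
    _ = ∫⁻ x : ({(0 : E)}ᶜ : Set E), φ ((homeomorphUnitSphereProd E x).2.1 •
          (homeomorphUnitSphereProd E x).1.1) ∂(μ.comap Subtype.val) := by
        refine lintegral_congr fun x => ?_
        rw [← homeomorphUnitSphereProd_symm_apply_coe, Homeomorph.symm_apply_apply]
    _ = ∫⁻ p, φ (p.2.1 • p.1.1)
          ∂(μ.toSphere.prod (Measure.volumeIoiPow (Module.finrank ℝ E - 1))) :=
        μ.measurePreserving_homeomorphUnitSphereProd.lintegral_comp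
          (f := fun p : Metric.sphere (0 : E) 1 × Set.Ioi (0 : ℝ) => φ (p.2.1 • p.1.1))
          (by fun_prop)
    _ = _ := lintegral_prod_symm' _ (by fun_prop)

/-- The distribution of `‖x‖ / √N` under Lebesgue measure on `ℝ^N`. Dividing by `√N` makes
Lebesgue measure the mixture, under this law, of the dilates of `σ^N`. -/
def radialLaw (N : ℕ) : Measure ℝ :=
  (volume : Measure (EuclideanSpace ℝ (Fin N))).toSphere Set.univ •
    (Measure.volumeIoiPow (N - 1)).map fun r : Set.Ioi (0 : ℝ) => r.1 / √(N : ℝ)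

variable {N : ℕ} [NeZero N]

theorem sqrt_pos_of_neZero : 0 < √(N : ℝ) :=
  Real.sqrt_pos.mpr (Nat.cast_pos.mpr (Nat.pos_of_neZero N))

theorem ae_radialLaw_pos : ∀ᵐ r ∂(radialLaw N), 0 < r := by
  refine Measure.ae_smul_measure ?_ _
  rw [ae_map_iff (by fun_prop) measurableSet_Ioi]
  exact ae_of_all _ fun r => div_pos r.2 sqrt_pos_of_neZero

theorem lintegral_sphere_eq_mul_lintegral_sigma {φ : EuclideanSpace ℝ (Fin N) → ℝ≥0∞}
    (hφ : Measurable φ) (r : ℝ) :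
    ∫⁻ u : Metric.sphere (0 : EuclideanSpace ℝ (Fin N)) 1, φ (r • u.1) ∂volume.toSphere =
      (volume : Measure (EuclideanSpace ℝ (Fin N))).toSphere Set.univ *
        ∫⁻ v : KacSphere N, φ ((r / √(N : ℝ)) • v.1) ∂(sigma N) := by
  have h0 : (volume : Measure (EuclideanSpace ℝ (Fin N))).toSphere Set.univ ≠ 0 :=
    Measure.measure_univ_ne_zero.mpr (Measure.toSphere_ne_zero _)
  rw [sigma, lintegral_map (by fun_prop) (continuous_dilate N).measurable,
    lintegral_smul_measure, smul_eq_mul, ← mul_assoc,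
    ENNReal.mul_inv_cancel h0 (measure_ne_top _ _), one_mul]
  simp only [dilate, smul_smul, div_mul_cancel₀ _ (sqrt_pos_of_neZero (N := N)).ne']

theorem lintegral_eq_lintegral_radialLaw {φ : EuclideanSpace ℝ (Fin N) → ℝ≥0∞}
    (hφ : Measurable φ) :
    ∫⁻ x, φ x = ∫⁻ r, ∫⁻ v : KacSphere N, φ (r • v.1) ∂(sigma N) ∂(radialLaw N) := by
  have hprod : Measurable fun p : ℝ × KacSphere N => φ (p.1 • p.2.1) := by fun_prop
  have hinner : Measurable fun r : ℝ => ∫⁻ v : KacSphere N, φ (r • v.1) ∂(sigma N) :=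
    hprod.lintegral_prod_right'
  have hscale : Measurable fun r : Set.Ioi (0 : ℝ) => r.1 / √(N : ℝ) := by fun_prop
  rw [radialLaw, lintegral_smul_measure, lintegral_map hinner hscale, smul_eq_mul,
    ← lintegral_const_mul _ (by exact hinner.comp hscale), lintegral_eq_lintegral_toSphere _ hφ,
    finrank_euclideanSpace_fin]
  exact lintegral_congr fun r => lintegral_sphere_eq_mul_lintegral_sigma hφ r

end Polar

section Shell

/-- The shell `(1 - ε) N ≤ ‖x‖ ^ 2 ≤ (1 + ε) N` around `S^{N-1}(√N)`. -/
def shell (N : ℕ) (ε : ℝ) : Set (EuclideanSpace ℝ (Fin N)) :=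
  {x | |‖x‖ ^ 2 - N| ≤ ε * N}

theorem measurableSet_shell (N : ℕ) (ε : ℝ) : MeasurableSet (shell N ε) :=
  measurableSet_le (by fun_prop) (by fun_prop)

/-- The radii `r` for which the dilate of `S^{N-1}(√N)` by `r` lies in `shell N ε`. -/
def shellRadii (ε : ℝ) : Set ℝ :=
  {r | |r ^ 2 - 1| ≤ ε}

theorem measurableSet_shellRadii (ε : ℝ) : MeasurableSet (shellRadii ε) :=
  measurableSet_le (by fun_prop) (by fun_prop)

variable {N : ℕ} [NeZero N] {ε : ℝ}

theorem smul_mem_shell_iff {r : ℝ} (v : KacSphere N) :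
    r • v.1 ∈ shell N ε ↔ r ∈ shellRadii ε := by
  have hN : (0 : ℝ) < N := Nat.cast_pos.mpr (Nat.pos_of_neZero N)
  rw [shell, shellRadii, Set.mem_ofPred_eq, Set.mem_ofPred_eq, norm_smul, mul_pow, norm_sq_eq,
    Real.norm_eq_abs, sq_abs, show r ^ 2 * (N : ℝ) - N = (r ^ 2 - 1) * N by ring, abs_mul,
    abs_of_pos hN, mul_le_mul_iff_left₀ hN]

theorem setLIntegral_shell_le {Ψ : EuclideanSpace ℝ (Fin N) → ℝ≥0∞} (hΨ : Measurable Ψ) {B : ℝ≥0∞}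
    (hB : ∀ v : KacSphere N, ∀ r ∈ shellRadii ε, 0 < r → Ψ (r • v.1) ≤ B * Ψ v.1) :
    ∫⁻ x in shell N ε, Ψ x ≤
      B * (∫⁻ v : KacSphere N, Ψ v.1 ∂(sigma N)) * radialLaw N (shellRadii ε) := by
  rw [← lintegral_indicator (measurableSet_shell N ε),
    lintegral_eq_lintegral_radialLaw (hΨ.indicator (measurableSet_shell N ε)),
    ← lintegral_indicator_const (measurableSet_shellRadii ε)]
  refine lintegral_mono_ae ?_
  filter_upwards [ae_radialLaw_pos] with r hr
  by_cases hrε : r ∈ shellRadii ε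
  · rw [Set.indicator_of_mem hrε, ← lintegral_const_mul _ (by fun_prop)]
    refine lintegral_mono fun v => ?_
    rw [Set.indicator_of_mem ((smul_mem_shell_iff v).mpr hrε)]
    exact hB v r hrε hr
  · simp [Set.indicator_of_notMem, smul_mem_shell_iff, hrε]

theorem radialLaw_mul_lintegral_le {Φ Φ' : EuclideanSpace ℝ (Fin N) → ℝ≥0∞} (hΦ' : Measurable Φ')
    {A : ℝ≥0∞} (hA : ∀ v : KacSphere N, ∀ r ∈ shellRadii ε, 0 < r → Φ v.1 ≤ A * Φ' (r • v.1)) :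
    radialLaw N (shellRadii ε) * ∫⁻ v : KacSphere N, Φ v.1 ∂(sigma N) ≤ A * ∫⁻ x, Φ' x := by
  rw [mul_comm, ← lintegral_indicator_const (measurableSet_shellRadii ε),
    lintegral_eq_lintegral_radialLaw hΦ', ← lintegral_const_mul]
  · refine lintegral_mono_ae ?_
    filter_upwards [ae_radialLaw_pos] with r hr
    by_cases hrε : r ∈ shellRadii ε
    · rw [Set.indicator_of_mem hrε, ← lintegral_const_mul _ (by fun_prop)]
      exact lintegral_mono fun v => hA v r hrε hr
    · rw [Set.indicator_of_notMem hrε]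
      exact zero_le
  · have hprod : Measurable fun p : ℝ × KacSphere N => Φ' (p.1 • p.2.1) := by fun_prop
    exact hprod.lintegral_prod_right'

/-- The radial mass of the shell, of which no estimate is available, cancels. -/
theorem setLIntegral_shell_mul_lintegral_le {Φ Φ' Ψ : EuclideanSpace ℝ (Fin N) → ℝ≥0∞}
    (hΦ' : Measurable Φ') (hΨ : Measurable Ψ) {A B : ℝ≥0∞}
    (hA : ∀ v : KacSphere N, ∀ r ∈ shellRadii ε, 0 < r → Φ v.1 ≤ A * Φ' (r • v.1))
    (hB : ∀ v : KacSphere N, ∀ r ∈ shellRadii ε, 0 < r → Ψ (r • v.1) ≤ B * Ψ v.1) :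
    (∫⁻ x in shell N ε, Ψ x) * ∫⁻ v : KacSphere N, Φ v.1 ∂(sigma N) ≤
      B * (∫⁻ v : KacSphere N, Ψ v.1 ∂(sigma N)) * (A * ∫⁻ x, Φ' x) := by
  calc (∫⁻ x in shell N ε, Ψ x) * ∫⁻ v : KacSphere N, Φ v.1 ∂(sigma N)
      ≤ (B * (∫⁻ v : KacSphere N, Ψ v.1 ∂(sigma N)) * radialLaw N (shellRadii ε)) *
          ∫⁻ v : KacSphere N, Φ v.1 ∂(sigma N) := by
        gcongr
        exact setLIntegral_shell_le hΨ hB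
    _ = (B * ∫⁻ v : KacSphere N, Ψ v.1 ∂(sigma N)) *
          (radialLaw N (shellRadii ε) * ∫⁻ v : KacSphere N, Φ v.1 ∂(sigma N)) := mul_assoc _ _ _
    _ ≤ _ := by
        gcongr B * _ * ?_
        exact radialLaw_mul_lintegral_le hΦ' hA

end Shell

section WithDensity

variable {α : Type*} [MeasurableSpace α] {μ : Measure α} {F : α → ℝ}

theorem integral_withDensity_ofReal (hF : Measurable F) (hF0 : ∀ x, 0 ≤ F x) (g : α → ℝ) :
    ∫ x, g x ∂(μ.withDensity fun x => ENNReal.ofReal (F x)) = ∫ x, g x * F x ∂μ := by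
  rw [integral_withDensity_eq_integral_toReal_smul hF.ennreal_ofReal
    (ae_of_all _ fun _ => ENNReal.ofReal_lt_top)]
  simp only [ENNReal.toReal_ofReal (hF0 _), smul_eq_mul, mul_comm]

theorem integrable_withDensity_ofReal_iff (hF : Measurable F) (hF0 : ∀ x, 0 ≤ F x) {g : α → ℝ} :
    Integrable g (μ.withDensity fun x => ENNReal.ofReal (F x)) ↔
      Integrable (fun x => g x * F x) μ := by
  rw [integrable_withDensity_iff hF.ennreal_ofReal (ae_of_all _ fun _ => ENNReal.ofReal_lt_top)]
  simp only [ENNReal.toReal_ofReal (hF0 _)]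

theorem isProbabilityMeasure_withDensity_ofReal (hF : Integrable F μ) (hF0 : ∀ x, 0 ≤ F x)
    (hF1 : ∫ x, F x ∂μ = 1) :
    IsProbabilityMeasure (μ.withDensity fun x => ENNReal.ofReal (F x)) := by
  refine ⟨?_⟩
  rw [withDensity_apply _ MeasurableSet.univ, Measure.restrict_univ,
    ← ofReal_integral_eq_lintegral_ofReal hF (ae_of_all _ hF0), hF1, ENNReal.ofReal_one]

theorem pi_withDensity_ofReal {ι : Type*} [Fintype ι] {X : ι → Type*}
    [∀ i, MeasurableSpace (X i)] {μ : ∀ i, Measure (X i)} [∀ i, SigmaFinite (μ i)]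
    {F : ∀ i, X i → ℝ} (hF : ∀ i, Integrable (F i) (μ i)) (hF0 : ∀ i x, 0 ≤ F i x) :
    Measure.pi (fun i => (μ i).withDensity fun x => ENNReal.ofReal (F i x)) =
      (Measure.pi μ).withDensity fun y => ENNReal.ofReal (∏ i, F i (y i)) := by
  have : ∀ i, IsFiniteMeasure ((μ i).withDensity fun x => ENNReal.ofReal (F i x)) := fun i =>
    isFiniteMeasure_withDensity_ofReal (hF i).2
  refine Measure.pi_eq fun s hs => ?_
  rw [withDensity_apply _ (MeasurableSet.univ_pi hs), Measure.restrict_pi_pi,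
    ← ofReal_integral_eq_lintegral_ofReal (Integrable.fintype_prod_dep fun i =>
      (hF i).integrableOn) (ae_of_all _ fun y => Finset.prod_nonneg fun i _ => hF0 i _),
    integral_fintype_prod_eq_prod,
    ENNReal.ofReal_prod_of_nonneg fun i _ => integral_nonneg (hF0 i)]
  refine Finset.prod_congr rfl fun i _ => ?_
  rw [withDensity_apply _ (hs i),
    ofReal_integral_eq_lintegral_ofReal (hF i).integrableOn (ae_of_all _ (hF0 i))]

end WithDensity

section Blocks

variable {ι κ τ X : Type*} [Fintype τ] [MeasurableSpace X] (μ : Measure X)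
  [IsProbabilityMeasure μ]

theorem pi_map_comp_injective [Fintype ι] [Fintype κ] {e : ι → κ} (he : Function.Injective e) :
    Measure.map (fun (y : κ → X) i => y (e i)) (Measure.pi fun _ => μ) =
      Measure.pi fun _ => μ := by
  have h := (ProbabilityTheory.iIndepFun_pi (μ := fun _ : κ => μ) (X := fun _ => id)
    fun _ => aemeasurable_id).precomp he
  simp only [id] at h
  rw [ProbabilityTheory.iIndepFun_iff_map_fun_eq_pi_map
    fun i => (measurable_pi_apply (e i)).aemeasurable] at h
  simpa only [(measurePreserving_eval (fun _ : κ => μ) _).map_eq] using h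

theorem pi_map_curry [Fintype ι] [Fintype κ] :
    Measure.map (fun (y : ι × κ → X) i j => y (i, j)) (Measure.pi fun _ => μ) =
      Measure.pi fun _ => Measure.pi fun _ => μ := by
  have h := Measure.infinitePi_map_curry (ι := ι) (κ := κ) fun _ _ => μ
  simp only [Measure.infinitePi_eq_pi] at h
  exact h

theorem iIndepFun_blocks [Finite ι] [Finite κ] {e : ι × κ → τ} (he : Function.Injective e) :
    ProbabilityTheory.iIndepFun (fun i (y : τ → X) j => y (e (i, j))) (Measure.pi fun _ => μ) := by
  have := Fintype.ofFinite ι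
  have := Fintype.ofFinite κ
  have hblock : ∀ i, Function.Injective fun j => e (i, j) := fun i =>
    he.comp (Prod.mk_right_injective i)
  rw [ProbabilityTheory.iIndepFun_iff_map_fun_eq_pi_map fun i =>
    Measurable.aemeasurable (by fun_prop)]
  simp only [pi_map_comp_injective μ (hblock _)]
  rw [← pi_map_curry, ← pi_map_comp_injective μ he, Measure.map_map (by fun_prop) (by fun_prop)]
  rfl

open ProbabilityTheory in
theorem hasSubgaussianMGF_sum_blocks [Fintype ι] [Fintype κ] {e : ι × κ → τ}
    (he : Function.Injective e) {g : (κ → X) → ℝ} (hg : Measurable g) {a b : ℝ}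
    (hgab : ∀ z, g z ∈ Set.Icc a b) :
    HasSubgaussianMGF
      (fun y : τ → X => ∑ i, (g (fun j => y (e (i, j))) - ∫ z, g z ∂(Measure.pi fun _ => μ)))
      (Fintype.card ι * (‖b - a‖₊ / 2) ^ 2) (Measure.pi fun _ => μ) := by
  have hblock : ∀ i, Function.Injective fun j => e (i, j) := fun i =>
    he.comp (Prod.mk_right_injective i)
  have hone := hasSubgaussianMGF_of_mem_Icc (μ := Measure.pi fun _ : κ => μ) hg.aemeasurable
    (ae_of_all _ hgab)
  have hindep := (iIndepFun_blocks μ he).comp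
    (fun _ z => g z - ∫ z, g z ∂(Measure.pi fun _ => μ)) fun _ => by fun_prop
  have hsum := HasSubgaussianMGF.sum_of_iIndepFun hindep (s := Finset.univ)
    (c := fun _ => (‖b - a‖₊ / 2) ^ 2) fun i _ => by
      refine HasSubgaussianMGF.of_map (Y := fun (y : τ → X) j => y (e (i, j)))
        (X := fun z => g z - ∫ z, g z ∂(Measure.pi fun _ => μ))
        (Measurable.aemeasurable (by fun_prop)) ?_
      rwa [pi_map_comp_injective μ (hblock i)]
  simpa using hsum

end Blocks

section OneParticleDensities

theorem lintegral_mul_prod_eq_lintegral_pi {f : ℝ → ℝ} (hm : Measurable f) (hf : Integrable f)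
    (hf0 : ∀ v, 0 ≤ f v) {N : ℕ} {G : EuclideanSpace ℝ (Fin N) → ℝ≥0∞} (hG : Measurable G) :
    ∫⁻ x : EuclideanSpace ℝ (Fin N), G x * ENNReal.ofReal (∏ j, f (x j)) =
      ∫⁻ y, G (WithLp.toLp 2 y) ∂(Measure.pi fun _ : Fin N => lineMeasure f) := by
  simp only [lineMeasure]
  rw [pi_withDensity_ofReal (fun _ => hf) (fun _ => hf0),
    lintegral_withDensity_eq_lintegral_mul _ (by fun_prop) (by fun_prop), ← volume_pi,
    ← (PiLp.volume_preserving_toLp (Fin N)).lintegral_comp (by fun_prop)]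
  simp only [Pi.mul_apply, mul_comm]

/-- A probability density on the line with second moment `1`, so that the tensor product `f^{⊗N}`
has mean energy `N`, and with finite fourth moment, so that this energy has a variance. -/
structure IsUnitEnergyDensity (f : ℝ → ℝ) : Prop where
  measurable : Measurable f
  nonneg : ∀ v, 0 ≤ f v
  integral_eq_one : ∫ v, f v = 1
  integral_sq_mul_eq_one : ∫ v, v ^ 2 * f v = 1
  integrable_pow_four_mul : Integrable fun v => v ^ 4 * f v

namespace IsUnitEnergyDensity

variable {f : ℝ → ℝ} (hf : IsUnitEnergyDensity f)

include hf

theorem integrable : Integrable f :=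
  integrable_of_integral_eq_one hf.integral_eq_one

theorem integral_lineMeasure (g : ℝ → ℝ) : ∫ v, g v ∂(lineMeasure f) = ∫ v, g v * f v :=
  integral_withDensity_ofReal hf.measurable hf.nonneg g

theorem integrable_lineMeasure_iff {g : ℝ → ℝ} :
    Integrable g (lineMeasure f) ↔ Integrable fun v => g v * f v :=
  integrable_withDensity_ofReal_iff hf.measurable hf.nonneg

theorem isProbabilityMeasure_lineMeasure : IsProbabilityMeasure (lineMeasure f) :=
  isProbabilityMeasure_withDensity_ofReal hf.integrable hf.nonneg hf.integral_eq_one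

theorem integrable_sq : Integrable (fun v => v ^ 2) (lineMeasure f) :=
  hf.integrable_lineMeasure_iff.mpr (integrable_of_integral_eq_one hf.integral_sq_mul_eq_one)

theorem memLp_sq : MemLp (fun v : ℝ => v ^ 2) 2 (lineMeasure f) := by
  rw [memLp_two_iff_integrable_sq (by fun_prop), hf.integrable_lineMeasure_iff]
  simpa only [← pow_mul] using hf.integrable_pow_four_mul

theorem integrable_sum_sq (k : ℕ) :
    Integrable (fun y : Fin k → ℝ => ∑ j, y j ^ 2) (Measure.pi fun _ => lineMeasure f) := by
  have := hf.isProbabilityMeasure_lineMeasure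
  exact integrable_finsetSum _ fun j _ =>
    integrable_comp_eval (μ := fun _ : Fin k => lineMeasure f) hf.integrable_sq

theorem integral_sum_sq (k : ℕ) :
    ∫ y, ∑ j, y j ^ 2 ∂(Measure.pi fun _ : Fin k => lineMeasure f) = k := by
  have := hf.isProbabilityMeasure_lineMeasure
  have hone (j : Fin k) : ∫ y, y j ^ 2 ∂(Measure.pi fun _ : Fin k => lineMeasure f) = 1 := by
    rw [integral_comp_eval (μ := fun _ : Fin k => lineMeasure f) (f := fun v => v ^ 2)
      (by fun_prop), hf.integral_lineMeasure, hf.integral_sq_mul_eq_one]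
  rw [integral_finsetSum _ fun j _ =>
    integrable_comp_eval (μ := fun _ : Fin k => lineMeasure f) hf.integrable_sq]
  simp only [hone, Finset.sum_const, Finset.card_univ, Fintype.card_fin, nsmul_eq_mul, mul_one]

theorem measure_energy_deviation_le {N : ℕ} [NeZero N] {ε : ℝ} (hε : 0 < ε) :
    (Measure.pi fun _ : Fin N => lineMeasure f) {y | ε * N ≤ |∑ j, y j ^ 2 - N|} ≤
      ENNReal.ofReal
        (ProbabilityTheory.variance (fun v => v ^ 2) (lineMeasure f) / ε ^ 2 * (N : ℝ)⁻¹) := by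
  have := hf.isProbabilityMeasure_lineMeasure
  have hN : (0 : ℝ) < N := Nat.cast_pos.mpr (Nat.pos_of_neZero N)
  have hmem : MemLp (∑ j, fun y : Fin N → ℝ => y j ^ 2) 2
      (Measure.pi fun _ : Fin N => lineMeasure f) :=
    memLp_finsetSum' _ fun j _ => hf.memLp_sq.comp_measurePreserving (measurePreserving_eval _ j)
  have hvar := ProbabilityTheory.variance_sum_pi (μ := fun _ : Fin N => lineMeasure f)
    (X := fun _ v => v ^ 2) fun _ => hf.memLp_sq
  have hcheb := ProbabilityTheory.meas_ge_le_variance_div_sq hmem (mul_pos hε hN)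
  rw [hvar] at hcheb
  simp only [Finset.sum_apply, hf.integral_sum_sq N, Finset.sum_const, Finset.card_univ,
    Fintype.card_fin, nsmul_eq_mul] at hcheb
  convert hcheb using 2
  field_simp

theorem eventually_half_le_setLIntegral_shell {ε : ℝ} (hε : 0 < ε) : ∀ᶠ N : ℕ in atTop,
    2⁻¹ ≤ ∫⁻ x in shell N ε, ENNReal.ofReal (∏ j, f (x j)) := by
  have := hf.isProbabilityMeasure_lineMeasure
  set V := ProbabilityTheory.variance (fun v : ℝ => v ^ 2) (lineMeasure f)
  have hlim : Tendsto (fun N : ℕ => ENNReal.ofReal (V / ε ^ 2 * (N : ℝ)⁻¹)) atTop (𝓝 0) := by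
    simpa using ENNReal.tendsto_ofReal
      ((tendsto_inv_atTop_nhds_zero_nat (𝕜 := ℝ)).const_mul (V / ε ^ 2))
  filter_upwards [hlim.eventually_le_const (u := 2⁻¹) (by simp), eventually_ge_atTop 1]
    with N hV hN
  have : NeZero N := ⟨by omega⟩
  have hS : MeasurableSet (WithLp.toLp 2 ⁻¹' shell N ε : Set (Fin N → ℝ)) :=
    (measurableSet_shell N ε).preimage (by fun_prop)
  have hcompl : (WithLp.toLp 2 ⁻¹' shell N ε : Set (Fin N → ℝ))ᶜ ⊆
      {y | ε * N ≤ |∑ j, y j ^ 2 - N|} := fun y hy => by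
    simp only [shell, Set.mem_compl_iff, Set.mem_preimage, Set.mem_ofPred_eq, not_le,
      EuclideanSpace.real_norm_sq_eq] at hy
    exact hy.le
  have hmass : ∫⁻ x in shell N ε, ENNReal.ofReal (∏ j, f (x j)) =
      (Measure.pi fun _ : Fin N => lineMeasure f) (WithLp.toLp 2 ⁻¹' shell N ε) := by
    rw [← lintegral_indicator (measurableSet_shell N ε), ← lintegral_indicator_one hS]
    refine (lintegral_congr fun x => ?_).trans (lintegral_mul_prod_eq_lintegral_pi
      hf.measurable hf.integrable hf.nonneg (measurable_one.indicator (measurableSet_shell N ε)))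
    by_cases hx : x ∈ shell N ε <;> simp [hx]
  rw [hmass, ← ENNReal.one_sub_inv_two, tsub_le_iff_right,
    ← measure_univ (μ := Measure.pi fun _ : Fin N => lineMeasure f),
    ← measure_add_measure_compl hS]
  gcongr
  exact (measure_mono hcompl).trans ((hf.measure_energy_deviation_le hε).trans hV)

end IsUnitEnergyDensity

/-- `f` is positive and `log f` is a `K`-Lipschitz function of the energy `v²`. The single
inequality `le_exp_mul` contains both directions, as it may be applied to `(x, y)` and `(y, x)`. -/
structure IsSqLogLipschitz (K : ℝ≥0) (f : ℝ → ℝ) : Prop where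
  pos : ∀ v, 0 < f v
  le_exp_mul : ∀ x y, f x ≤ Real.exp (K * |x ^ 2 - y ^ 2|) * f y

namespace IsSqLogLipschitz

variable {K : ℝ≥0} {f : ℝ → ℝ} (hf : IsSqLogLipschitz K f)

include hf

theorem log_sub_log_le (x y : ℝ) : Real.log (f x) - Real.log (f y) ≤ K * |x ^ 2 - y ^ 2| := by
  have h := Real.log_le_log (hf.pos x) (hf.le_exp_mul x y)
  rw [Real.log_mul (Real.exp_pos _).ne' (hf.pos y).ne', Real.log_exp] at h
  linarith

theorem abs_log_sub_log_le (x y : ℝ) :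
    |Real.log (f x) - Real.log (f y)| ≤ K * |x ^ 2 - y ^ 2| :=
  abs_sub_le_iff.mpr ⟨hf.log_sub_log_le x y, abs_sub_comm (x ^ 2) _ ▸ hf.log_sub_log_le y x⟩

theorem continuous_log : Continuous fun v => Real.log (f v) := by
  refine continuous_iff_continuousAt.mpr fun y => tendsto_iff_dist_tendsto_zero.mpr ?_
  have hlim : Tendsto (fun x : ℝ => K * |x ^ 2 - y ^ 2|) (𝓝 y) (𝓝 0) := by
    have hcont : Continuous fun x : ℝ => K * |x ^ 2 - y ^ 2| := by fun_prop
    simpa using hcont.tendsto y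
  exact squeeze_zero (fun _ => dist_nonneg) (fun x => hf.abs_log_sub_log_le x y) hlim

theorem continuous : Continuous f :=
  (Real.continuous_exp.comp hf.continuous_log).congr fun v => Real.exp_log (hf.pos v)

theorem mono {L : ℝ≥0} (hKL : K ≤ L) : IsSqLogLipschitz L f where
  pos := hf.pos
  le_exp_mul x y := (hf.le_exp_mul x y).trans <| by
    gcongr
    exact (hf.pos y).le

theorem const_mul {p : ℝ} (hp : 0 < p) : IsSqLogLipschitz K fun v => p * f v where
  pos v := mul_pos hp (hf.pos v)
  le_exp_mul x y := by
    rw [mul_left_comm]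
    exact mul_le_mul_of_nonneg_left (hf.le_exp_mul x y) hp.le

theorem add {g : ℝ → ℝ} (hg : IsSqLogLipschitz K g) : IsSqLogLipschitz K fun v => f v + g v where
  pos v := add_pos (hf.pos v) (hg.pos v)
  le_exp_mul x y := by
    rw [mul_add]
    exact add_le_add (hf.le_exp_mul x y) (hg.le_exp_mul x y)

end IsSqLogLipschitz

end OneParticleDensities

section ConditionedTensorProduct

variable {N : ℕ}

theorem continuous_firstCoords (k N : ℕ) : Continuous (firstCoords k N) := by
  refine continuous_pi fun i => ?_
  unfold firstCoords
  split_ifs <;> fun_prop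

theorem firstCoords_eq {k : ℕ} (h : k ≤ N) (v : KacSphere N) :
    firstCoords k N v = fun j => v.1 (Fin.castLE h j) :=
  funext fun j => dif_pos (j.2.trans_le h)

theorem permute_apply (π : Equiv.Perm (Fin N)) (v : KacSphere N) (i : Fin N) :
    (permute π v).1 i = v.1 (π.symm i) := by
  simp [permute, LinearIsometryEquiv.piLpCongrLeft_apply]

theorem measurePreserving_permute (π : Equiv.Perm (Fin N)) :
    MeasurePreserving (permute π) (sigma N) (sigma N) :=
  measurePreserving_sphereMap_sigma (LinearIsometryEquiv.piLpCongrLeft 2 ℝ ℝ π)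

theorem condTensor_permute (f : ℝ → ℝ) (π : Equiv.Perm (Fin N)) (v : KacSphere N) :
    condTensor f N (permute π v) = condTensor f N v := by
  simp only [condTensor, permute_apply, Equiv.prod_comp π.symm fun j => f (v.1 j)]

variable {f : ℝ → ℝ} (hf : Continuous f) (hpos : ∀ v, 0 < f v)

include hf in
theorem continuous_condTensor : Continuous (condTensor f N) := by
  unfold condTensor
  fun_prop

include hf in
theorem map_permute_densityMeasure (π : Equiv.Perm (Fin N)) :
    Measure.map (permute π) (densityMeasure N (condTensor f N)) =
      densityMeasure N (condTensor f N) := by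
  have hπ := measurePreserving_permute π
  have hF : Measurable (condTensor f N) := (continuous_condTensor hf).measurable
  refine Measure.ext fun s hs => ?_
  rw [Measure.map_apply hπ.measurable hs, densityMeasure, withDensity_apply _ (hπ.measurable hs),
    withDensity_apply _ hs, ← hπ.setLIntegral_comp_preimage hs (by fun_prop)]
  simp only [condTensor_permute]

include hf in
theorem integral_comp_coords {k : ℕ} (h : k ≤ N) {e : Fin k → Fin N} (he : Function.Injective e)
    {g : (Fin k → ℝ) → ℝ} (hg : Continuous g) :
    ∫ v : KacSphere N, g (fun j => v.1 (e j)) ∂(densityMeasure N (condTensor f N)) =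
      ∫ v, g (firstCoords k N v) ∂(densityMeasure N (condTensor f N)) := by
  obtain ⟨π, hπ⟩ := Equiv.Perm.exists_extending_pair e (Fin.castLE h) he (Fin.castLE_injective h)
  conv_rhs => rw [← map_permute_densityMeasure hf π]
  have hgc : Continuous fun v => g (firstCoords k N v) := hg.comp (continuous_firstCoords k N)
  rw [integral_map (measurePreserving_permute π).measurable.aemeasurable hgc.aestronglyMeasurable]
  simp only [firstCoords_eq h, permute_apply, ← hπ, Equiv.symm_apply_apply]

variable [NeZero N]

include hf hpos

theorem Z_pos : 0 < Z N f := by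
  have hprod : Continuous fun v : KacSphere N => ∏ j, f (v.1 j) := by fun_prop
  refine (integral_pos_iff_support_of_nonneg
    (fun _ => Finset.prod_nonneg fun _ _ => (hpos _).le) (integrable_of_continuous hprod)).mpr ?_
  rw [Function.support_eq_univ fun _ => (Finset.prod_pos fun _ _ => hpos _).ne',
    measure_univ]
  exact one_pos

theorem condTensor_pos (v : KacSphere N) : 0 < condTensor f N v :=
  div_pos (Finset.prod_pos fun _ _ => hpos _) (Z_pos hf hpos)

theorem integral_condTensor : ∫ v, condTensor f N v ∂(sigma N) = 1 := by
  simp only [condTensor, integral_div]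
  exact div_self (Z_pos hf hpos).ne'

theorem isProbDensity_condTensor : IsProbDensity N (condTensor f N) :=
  ⟨(continuous_condTensor hf).measurable, fun v => (condTensor_pos hf hpos v).le,
    integrable_of_continuous (continuous_condTensor hf), integral_condTensor hf hpos⟩

theorem isProbabilityMeasure_densityMeasure :
    IsProbabilityMeasure (densityMeasure N (condTensor f N)) :=
  isProbabilityMeasure_withDensity_ofReal (integrable_of_continuous (continuous_condTensor hf))
    (fun v => (condTensor_pos hf hpos v).le) (integral_condTensor hf hpos)

theorem integral_densityMeasure (g : KacSphere N → ℝ) :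
    ∫ v, g v ∂(densityMeasure N (condTensor f N)) = ∫ v, g v * condTensor f N v ∂(sigma N) :=
  integral_withDensity_ofReal (continuous_condTensor hf).measurable
    (fun v => (condTensor_pos hf hpos v).le) g

theorem integrable_densityMeasure_of_continuous {g : KacSphere N → ℝ} (hg : Continuous g) :
    Integrable g (densityMeasure N (condTensor f N)) :=
  (integrable_withDensity_ofReal_iff (continuous_condTensor hf).measurable
    fun v => (condTensor_pos hf hpos v).le).mpr
      (integrable_of_continuous (hg.mul (continuous_condTensor hf)))

end ConditionedTensorProduct

section Comparison

variable {N : ℕ} {K K' : ℝ≥0} {f g : ℝ → ℝ} {ε : ℝ}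

namespace IsSqLogLipschitz

theorem prod_le_exp_mul_prod (hf : IsSqLogLipschitz K f) {x y : EuclideanSpace ℝ (Fin N)} {δ : ℝ}
    (hxy : ∑ j, |x j ^ 2 - y j ^ 2| ≤ δ) :
    ∏ j, f (x j) ≤ Real.exp (K * δ) * ∏ j, f (y j) := by
  have hpos := hf.pos
  calc ∏ j, f (x j) ≤ ∏ j, Real.exp (K * |x j ^ 2 - y j ^ 2|) * f (y j) :=
        Finset.prod_le_prod (fun j _ => (hpos _).le) fun j _ => hf.le_exp_mul _ _
    _ = Real.exp (K * ∑ j, |x j ^ 2 - y j ^ 2|) * ∏ j, f (y j) := by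
        rw [Finset.prod_mul_distrib, ← Real.exp_sum, ← Finset.mul_sum]
    _ ≤ Real.exp (K * δ) * ∏ j, f (y j) := by
        have : 0 ≤ ∏ j, f (y j) := Finset.prod_nonneg fun j _ => (hpos _).le
        gcongr

end IsSqLogLipschitz

theorem sum_abs_sq_sub_sq_le {r : ℝ} (hr : r ∈ shellRadii ε) (v : KacSphere N) :
    ∑ j, |(r • v.1) j ^ 2 - v.1 j ^ 2| ≤ ε * N := by
  have hterm (j : Fin N) : |(r • v.1) j ^ 2 - v.1 j ^ 2| = |r ^ 2 - 1| * v.1 j ^ 2 := by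
    rw [PiLp.smul_apply, smul_eq_mul, mul_pow, ← sub_one_mul, abs_mul, abs_sq]
  simp only [hterm, ← Finset.mul_sum, sum_sq_eq]
  exact mul_le_mul_of_nonneg_right hr N.cast_nonneg

theorem ofReal_Z_eq_lintegral (hf : Continuous f) (hf0 : ∀ v, 0 ≤ f v) :
    ENNReal.ofReal (Z N f) = ∫⁻ v : KacSphere N, ENNReal.ofReal (∏ j, f (v.1 j)) ∂(sigma N) :=
  ofReal_integral_eq_lintegral_ofReal (integrable_of_continuous (by fun_prop))
    (ae_of_all _ fun _ => Finset.prod_nonneg fun _ _ => hf0 _)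

theorem exp_mul_prod_le_exp_mul_of_mem_shellRadii (hf : IsSqLogLipschitz K f) {r : ℝ}
    (hr : r ∈ shellRadii ε) {s t κ : ℝ} (hst : s ≤ κ + t) (v : KacSphere N) :
    Real.exp s * ∏ j, f (v.1 j) ≤
      Real.exp (κ + K * (ε * N)) * (Real.exp t * ∏ j, f ((r • v.1) j)) := by
  have hdist := sum_abs_sq_sub_sq_le hr v
  simp only [abs_sub_comm (_ ^ 2) (v.1 _ ^ 2)] at hdist
  calc Real.exp s * ∏ j, f (v.1 j)
      ≤ Real.exp (κ + t) * (Real.exp (K * (ε * N)) * ∏ j, f ((r • v.1) j)) :=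
        mul_le_mul (Real.exp_le_exp.mpr hst) (hf.prod_le_exp_mul_prod hdist)
          (Finset.prod_nonneg fun j _ => (hf.pos _).le) (Real.exp_pos _).le
    _ = _ := by rw [Real.exp_add, Real.exp_add]; ring

/-- Dilations within the shell change `f^{⊗N}` and `g^{⊗N}` by subexponential factors only. -/
theorem lintegral_exp_mul_prod_le [NeZero N] (hf : IsSqLogLipschitz K f)
    (hg : IsSqLogLipschitz K' g)
    (hmass : 2⁻¹ ≤ ∫⁻ x in shell N ε, ENNReal.ofReal (∏ j, g (x j)))
    {G : EuclideanSpace ℝ (Fin N) → ℝ} (hG : Continuous G) {κ : ℝ}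
    (hκ : ∀ v : KacSphere N, ∀ r ∈ shellRadii ε, 0 < r → G v.1 ≤ κ + G (r • v.1)) :
    ∫⁻ v : KacSphere N, ENNReal.ofReal (Real.exp (G v.1) * ∏ j, f (v.1 j)) ∂(sigma N) ≤
      ENNReal.ofReal (2 * Real.exp (κ + (K + K') * (ε * N)) * Z N g) *
        ∫⁻ x, ENNReal.ofReal (Real.exp (G x)) * ENNReal.ofReal (∏ j, f (x j)) := by
  have hfc := hf.continuous
  have hgc := hg.continuous
  have hA (v : KacSphere N) (r : ℝ) (hr : r ∈ shellRadii ε) (hr0 : 0 < r) :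
      ENNReal.ofReal (Real.exp (G v.1) * ∏ j, f (v.1 j)) ≤
        ENNReal.ofReal (Real.exp (κ + K * (ε * N))) *
          (ENNReal.ofReal (Real.exp (G (r • v.1))) * ENNReal.ofReal (∏ j, f ((r • v.1) j))) := by
    rw [← ENNReal.ofReal_mul (Real.exp_pos _).le, ← ENNReal.ofReal_mul (Real.exp_pos _).le]
    exact ENNReal.ofReal_le_ofReal
      (exp_mul_prod_le_exp_mul_of_mem_shellRadii hf hr (hκ v r hr hr0) v)
  have hB (v : KacSphere N) (r : ℝ) (hr : r ∈ shellRadii ε) (_ : 0 < r) :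
      ENNReal.ofReal (∏ j, g ((r • v.1) j)) ≤
        ENNReal.ofReal (Real.exp (K' * (ε * N))) * ENNReal.ofReal (∏ j, g (v.1 j)) := by
    rw [← ENNReal.ofReal_mul (Real.exp_pos _).le]
    exact ENNReal.ofReal_le_ofReal (hg.prod_le_exp_mul_prod (sum_abs_sq_sub_sq_le hr v))
  have key := setLIntegral_shell_mul_lintegral_le
    (Φ := fun x => ENNReal.ofReal (Real.exp (G x) * ∏ j, f (x j)))
    (Φ' := fun x => ENNReal.ofReal (Real.exp (G x)) * ENNReal.ofReal (∏ j, f (x j)))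
    (Ψ := fun x => ENNReal.ofReal (∏ j, g (x j))) (by fun_prop) (by fun_prop) hA hB
  rw [← ofReal_Z_eq_lintegral hgc fun v => (hg.pos v).le] at key
  rw [← ENNReal.mul_le_mul_iff_right (a := 2⁻¹) (by simp) (by simp)]
  refine (mul_le_mul_left hmass _).trans (key.trans_eq ?_)
  rw [mul_assoc 2, ENNReal.ofReal_mul zero_le_two, ENNReal.ofReal_ofNat, mul_assoc 2,
    ENNReal.inv_mul_cancel_left (by simp) (by simp),
    show κ + (K + K') * (ε * N) = κ + K * (ε * N) + K' * (ε * N) by ring,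
    Real.exp_add (κ + _), ENNReal.ofReal_mul (by positivity),
    ENNReal.ofReal_mul (Real.exp_pos _).le]
  ring

theorem Z_le_mul_Z [NeZero N] (hf : IsSqLogLipschitz K f) (hf1 : ∫ v, f v = 1)
    (hg : IsSqLogLipschitz K' g)
    (hmass : 2⁻¹ ≤ ∫⁻ x in shell N ε, ENNReal.ofReal (∏ j, g (x j))) :
    Z N f ≤ 2 * Real.exp ((K + K') * (ε * N)) * Z N g := by
  have := isProbabilityMeasure_withDensity_ofReal (integrable_of_integral_eq_one hf1)
    (fun v => (hf.pos v).le) hf1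
  have hZ : 0 < Z N g := Z_pos hg.continuous hg.pos
  have key := lintegral_exp_mul_prod_le hf hg hmass (G := 0) (κ := 0) continuous_zero
    fun _ _ _ _ => by simp
  rw [lintegral_mul_prod_eq_lintegral_pi hf.continuous.measurable
    (integrable_of_integral_eq_one hf1) (fun v => (hf.pos v).le) (by fun_prop)] at key
  simp only [Pi.zero_apply, Real.exp_zero, one_mul, ENNReal.ofReal_one, lintegral_one,
    lineMeasure, measure_univ, mul_one, zero_add] at key
  rwa [← ofReal_Z_eq_lintegral hf.continuous fun v => (hf.pos v).le,
    ENNReal.ofReal_le_ofReal_iff (by positivity)] at key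

theorem integral_exp_densityMeasure_le [NeZero N] (hf : IsSqLogLipschitz K f)
    (hf1 : ∫ v, f v = 1)
    (hmass : 2⁻¹ ≤ ∫⁻ x in shell N ε, ENNReal.ofReal (∏ j, f (x j)))
    {G : EuclideanSpace ℝ (Fin N) → ℝ} (hG : Continuous G) {κ : ℝ}
    (hκ : ∀ v : KacSphere N, ∀ r ∈ shellRadii ε, 0 < r → G v.1 ≤ κ + G (r • v.1))
    (hint : Integrable (fun y => Real.exp (G (WithLp.toLp 2 y)))
      (Measure.pi fun _ : Fin N => lineMeasure f)) :
    ∫ v, Real.exp (G v.1) ∂(densityMeasure N (condTensor f N)) ≤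
      2 * Real.exp (κ + (K + K) * (ε * N)) *
        ∫ y, Real.exp (G (WithLp.toLp 2 y)) ∂(Measure.pi fun _ : Fin N => lineMeasure f) := by
  have hZ : 0 < Z N f := Z_pos hf.continuous hf.pos
  have hcont : Continuous fun v : KacSphere N => Real.exp (G v.1) * ∏ j, f (v.1 j) := by
    have := hf.continuous
    fun_prop
  have key := lintegral_exp_mul_prod_le hf hf hmass hG hκ
  rw [lintegral_mul_prod_eq_lintegral_pi hf.continuous.measurable
      (integrable_of_integral_eq_one hf1) (fun v => (hf.pos v).le) (by fun_prop),
    ← ofReal_integral_eq_lintegral_ofReal hint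
      (ae_of_all _ fun _ => (Real.exp_pos _).le),
    ← ofReal_integral_eq_lintegral_ofReal (integrable_of_continuous hcont)
      (ae_of_all _ fun v => mul_nonneg (Real.exp_pos _).le
        (Finset.prod_nonneg fun j _ => (hf.pos _).le)),
    ← ENNReal.ofReal_mul (by positivity), ENNReal.ofReal_le_ofReal_iff (by positivity)] at key
  rw [integral_densityMeasure hf.continuous hf.pos]
  simp only [condTensor, ← mul_div_assoc, integral_div]
  rw [div_le_iff₀ hZ]
  linarith

theorem integral_densityMeasure_le_add_cgf [NeZero N] (hf : IsSqLogLipschitz K f)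
    (hf1 : ∫ v, f v = 1)
    (hmass : 2⁻¹ ≤ ∫⁻ x in shell N ε, ENNReal.ofReal (∏ j, f (x j)))
    {G : EuclideanSpace ℝ (Fin N) → ℝ} (hG : Continuous G) {κ : ℝ}
    (hκ : ∀ v : KacSphere N, ∀ r ∈ shellRadii ε, 0 < r → G v.1 ≤ κ + G (r • v.1))
    (hint : Integrable (fun y => Real.exp (G (WithLp.toLp 2 y)))
      (Measure.pi fun _ : Fin N => lineMeasure f)) :
    ∫ v, G v.1 ∂(densityMeasure N (condTensor f N)) ≤
      Real.log 2 + (κ + (K + K) * (ε * N)) + Real.log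
        (∫ y, Real.exp (G (WithLp.toLp 2 y)) ∂(Measure.pi fun _ : Fin N => lineMeasure f)) := by
  have : IsProbabilityMeasure (lineMeasure f) := isProbabilityMeasure_withDensity_ofReal
    (integrable_of_integral_eq_one hf1) (fun v => (hf.pos v).le) hf1
  have := isProbabilityMeasure_densityMeasure (N := N) hf.continuous hf.pos
  have hmgf_pos := integral_exp_pos hint
  have hG_sphere : Continuous fun v : KacSphere N => G v.1 := hG.comp continuous_subtype_val
  have hjensen := convexOn_exp.map_integral_le Real.continuous_exp.continuousOn isClosed_univ
    (ae_of_all (densityMeasure N (condTensor f N)) fun _ => Set.mem_univ _)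
    (integrable_densityMeasure_of_continuous hf.continuous hf.pos hG_sphere)
    (integrable_densityMeasure_of_continuous hf.continuous hf.pos
      (Real.continuous_exp.comp hG_sphere))
  have hlog := Real.log_le_log (Real.exp_pos _)
    (hjensen.trans (integral_exp_densityMeasure_le hf hf1 hmass hG hκ hint))
  rwa [Real.log_mul (by positivity) hmgf_pos.ne', Real.log_mul two_ne_zero
    (Real.exp_pos _).ne', Real.log_exp, Real.log_exp] at hlog

end Comparison

section BlockSums

variable {ι κ : Type*} [Fintype ι] {N : ℕ}

/-- The sum of `h` over the blocks of coordinates `x (e (i, ·))`, which are disjoint when `e` is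
injective. -/
def blockSum (e : ι × κ → Fin N) (h : (κ → ℝ) → ℝ) (x : EuclideanSpace ℝ (Fin N)) : ℝ :=
  ∑ i, h fun j => x (e (i, j))

variable {e : ι × κ → Fin N} {h : (κ → ℝ) → ℝ}

theorem continuous_blockSum (hh : Continuous h) : Continuous (blockSum e h) := by
  unfold blockSum
  fun_prop

variable [Fintype κ]

theorem abs_sub_one_le_abs_sq_sub_one {r : ℝ} (hr : 0 < r) : |r - 1| ≤ |r ^ 2 - 1| := by
  rw [show r ^ 2 - 1 = (r - 1) * (r + 1) by ring, abs_mul, abs_of_pos (by linarith : 0 < r + 1)]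
  nlinarith [abs_nonneg (r - 1)]

theorem dist_self_smul_le {r ε : ℝ} (hr : r ∈ shellRadii ε) (hr0 : 0 < r) (x : κ → ℝ) :
    dist x (r • x) ≤ ε * (1 + ∑ j, x j ^ 2) := by
  have hε : 0 ≤ ε := (abs_nonneg _).trans hr
  refine (dist_pi_le_iff (by positivity)).mpr fun j => ?_
  have hxj : |x j| ≤ 1 + x j ^ 2 := by
    rw [← sq_abs]
    nlinarith [sq_nonneg (|x j| - 1), abs_nonneg (x j)]
  have hj : x j ^ 2 ≤ ∑ j, x j ^ 2 :=
    Finset.single_le_sum (f := fun j => x j ^ 2) (fun _ _ => sq_nonneg _) (Finset.mem_univ j)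
  calc dist (x j) ((r • x) j) = |r - 1| * |x j| := by
        rw [Real.dist_eq, abs_sub_comm, Pi.smul_apply, smul_eq_mul, ← sub_one_mul, abs_mul]
    _ ≤ ε * (1 + ∑ j, x j ^ 2) :=
        mul_le_mul ((abs_sub_one_le_abs_sq_sub_one hr0).trans hr) (by linarith) (abs_nonneg _) hε

theorem sum_sq_comp_le (he : Function.Injective e) (v : KacSphere N) :
    ∑ i, ∑ j, v.1 (e (i, j)) ^ 2 ≤ N := by
  rw [← Fintype.sum_prod_type' (f := fun i j => v.1 (e (i, j)) ^ 2),
    ← Finset.sum_image (f := fun j => v.1 j ^ 2) (s := Finset.univ) (g := e) he.injOn]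
  exact (Finset.sum_le_univ_sum_of_nonneg fun _ => sq_nonneg _).trans_eq (sum_sq_eq v)

theorem blockSum_le_add_blockSum_smul (he : Function.Injective e) {L : ℝ≥0}
    (hL : LipschitzWith L h) {r ε : ℝ} (hr : r ∈ shellRadii ε) (hr0 : 0 < r) (v : KacSphere N) :
    blockSum e h v.1 ≤ L * (ε * (Fintype.card ι + N)) + blockSum e h (r • v.1) := by
  have hε : 0 ≤ ε := (abs_nonneg _).trans hr
  have hblock (i : ι) : h (fun j => v.1 (e (i, j))) ≤
      L * (ε * (1 + ∑ j, v.1 (e (i, j)) ^ 2)) + h (fun j => (r • v.1) (e (i, j))) := by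
    have hdist := (le_abs_self _).trans (hL.dist_le_mul (fun j => v.1 (e (i, j)))
      (r • fun j => v.1 (e (i, j))))
    have hscale := mul_le_mul_of_nonneg_left
      (dist_self_smul_le hr hr0 fun j => v.1 (e (i, j))) L.2
    exact sub_le_iff_le_add.mp (hdist.trans hscale)
  refine (Finset.sum_le_sum fun i _ => hblock i).trans ?_
  rw [Finset.sum_add_distrib, ← Finset.mul_sum, ← Finset.mul_sum, Finset.sum_add_distrib,
    Finset.sum_const, Finset.card_univ, nsmul_eq_mul, mul_one]
  have := sum_sq_comp_le he v
  unfold blockSum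
  gcongr

theorem integral_blockSum_densityMeasure [NeZero N] {f : ℝ → ℝ} (hf : Continuous f)
    (hpos : ∀ v, 0 < f v) {k : ℕ} (hk : k ≤ N) {e : ι × Fin k → Fin N}
    (he : Function.Injective e) {h : (Fin k → ℝ) → ℝ} (hh : Continuous h) :
    ∫ v, blockSum e h v.1 ∂(densityMeasure N (condTensor f N)) =
      Fintype.card ι * ∫ v, h (firstCoords k N v) ∂(densityMeasure N (condTensor f N)) := by
  have hblock (i : ι) : Function.Injective fun j => e (i, j) :=
    he.comp (Prod.mk_right_injective i)
  simp only [blockSum]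
  rw [integral_finsetSum _ fun i _ =>
    integrable_densityMeasure_of_continuous hf hpos (by fun_prop)]
  simp only [integral_comp_coords hf hk (hblock _) hh, Finset.sum_const, Finset.card_univ,
    nsmul_eq_mul]

end BlockSums

section Chaos

variable {K : ℝ≥0} {f : ℝ → ℝ} {k : ℕ}

theorem mul_integral_firstCoords_sub_le {N : ℕ} [NeZero N] (hf : IsSqLogLipschitz K f)
    (hf1 : ∫ v, f v = 1) (hk : k ≤ N) {ε : ℝ}
    (hmass : 2⁻¹ ≤ ∫⁻ x in shell N ε, ENNReal.ofReal (∏ j, f (x j)))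
    {ι : Type*} [Fintype ι] {e : ι × Fin k → Fin N} (he : Function.Injective e)
    {g : (Fin k → ℝ) → ℝ} {L : ℝ≥0} (hL : LipschitzWith L g) {a b : ℝ}
    (hgab : ∀ z, g z ∈ Set.Icc a b) {lam : ℝ} (hlam : 0 ≤ lam) :
    lam * (Fintype.card ι * (∫ v, g (firstCoords k N v) ∂(densityMeasure N (condTensor f N)) -
        ∫ z, g z ∂(Measure.pi fun _ : Fin k => lineMeasure f))) ≤
      Real.log 2 + (lam * (L * (ε * (Fintype.card ι + N))) + (K + K) * (ε * N)) +
        Fintype.card ι * ((b - a) / 2) ^ 2 * lam ^ 2 / 2 := by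
  have : IsProbabilityMeasure (lineMeasure f) := isProbabilityMeasure_withDensity_ofReal
    (integrable_of_integral_eq_one hf1) (fun v => (hf.pos v).le) hf1
  have := isProbabilityMeasure_densityMeasure (N := N) hf.continuous hf.pos
  set m := ∫ z, g z ∂(Measure.pi fun _ : Fin k => lineMeasure f)
  set P := densityMeasure N (condTensor f N)
  have hgL : LipschitzWith L fun z => g z - m := by
    simpa using hL.sub (LipschitzWith.const m)
  have hS : Continuous fun x => lam * blockSum e (fun z => g z - m) x :=
    (continuous_blockSum hgL.continuous).const_mul lam
  have hmean : ∫ v, lam * blockSum e (fun z => g z - m) v.1 ∂P =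
      lam * (Fintype.card ι * (∫ v, g (firstCoords k N v) ∂P - m)) := by
    have hg : Integrable (fun v => g (firstCoords k N v)) P :=
      integrable_densityMeasure_of_continuous hf.continuous hf.pos
        (hL.continuous.comp (continuous_firstCoords k N))
    rw [integral_const_mul, integral_blockSum_densityMeasure hf.continuous hf.pos hk he
      hgL.continuous, integral_sub hg (integrable_const m), integral_const, probReal_univ, one_smul]
  have hosc (v : KacSphere N) (r : ℝ) (hr : r ∈ shellRadii ε) (hr0 : 0 < r) :
      lam * blockSum e (fun z => g z - m) v.1 ≤ lam * (L * (ε * (Fintype.card ι + N))) +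
        lam * blockSum e (fun z => g z - m) (r • v.1) := by
    rw [← mul_add]
    exact mul_le_mul_of_nonneg_left (blockSum_le_add_blockSum_smul he hgL hr hr0 v) hlam
  have hsub := hasSubgaussianMGF_sum_blocks (lineMeasure f) he hL.continuous.measurable hgab
  have hmgf := Real.log_le_log (integral_exp_pos (hsub.integrable_exp_mul lam)) (hsub.mgf_le lam)
  rw [Real.log_exp] at hmgf
  have htransfer := integral_densityMeasure_le_add_cgf hf hf1 hmass hS hosc
    (hsub.integrable_exp_mul lam)
  rw [hmean] at htransfer
  refine htransfer.trans (add_le_add_right (hmgf.trans_eq ?_) _)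
  simp [div_pow]

theorem eventually_integral_firstCoords_le (hf : IsSqLogLipschitz K f)
    (hfE : IsUnitEnergyDensity f) (hk : 1 ≤ k) {g : (Fin k → ℝ) → ℝ} {L : ℝ≥0}
    (hL : LipschitzWith L g) {a b : ℝ} (hgab : ∀ z, g z ∈ Set.Icc a b) {η : ℝ} (hη : 0 < η) :
    ∀ᶠ N : ℕ in atTop, ∫ v, g (firstCoords k N v) ∂(densityMeasure N (condTensor f N)) ≤
      ∫ z, g z ∂(Measure.pi fun _ : Fin k => lineMeasure f) + η := by
  obtain ⟨lam, hlam, hlam_le⟩ :=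
    exists_pos_mul_lt (by positivity : 0 < η / 3) (((b - a) / 2) ^ 2 / 2)
  obtain ⟨ε, hε, hε_le⟩ := exists_pos_mul_lt (by positivity : 0 < lam * (η / 3))
    (lam * (L * (1 + 2 * k)) + (K + K) * (2 * k))
  have hlim : Tendsto (fun N : ℕ => ((N / k : ℕ) : ℝ)) atTop atTop :=
    tendsto_natCast_atTop_atTop.comp (Nat.tendsto_div_const_atTop (by omega))
  filter_upwards [hfE.eventually_half_le_setLIntegral_shell hε, eventually_ge_atTop k,
    hlim.eventually_ge_atTop (Real.log 2 / (lam * (η / 3)))] with N hmass hN hM_ge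
  have : NeZero N := ⟨by omega⟩
  have hM_pos : 1 ≤ N / k := (Nat.one_le_div_iff (by omega)).mpr hN
  have hblock : Function.Injective fun p : Fin (N / k) × Fin k =>
      Fin.castLE (Nat.div_mul_le_self N k) (finProdFinEquiv p) :=
    (Fin.castLE_injective _).comp finProdFinEquiv.injective
  have hmain := mul_integral_firstCoords_sub_le hf hfE.integral_eq_one hN hmass hblock hL hgab
    hlam.le
  rw [Fintype.card_fin] at hmain
  have hNM : (N : ℝ) ≤ 2 * k * (N / k : ℕ) := by
    have hlt : N < k * (N / k) + k := Nat.lt_mul_div_succ N (by omega)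
    have hle : k ≤ k * (N / k) := Nat.le_mul_of_pos_right k hM_pos
    have hle' : N ≤ 2 * k * (N / k) := by linarith
    exact_mod_cast hle'
  set M : ℝ := ((N / k : ℕ) : ℝ)
  have hM : 0 < M := Nat.cast_pos.mpr hM_pos
  rw [div_le_iff₀ (by positivity)] at hM_ge
  have hlip : lam * (L * (ε * (M + N))) + (K + K) * (ε * N) ≤ M * (lam * (η / 3)) :=
    calc lam * (L * (ε * (M + N))) + (K + K) * (ε * N)
        ≤ lam * (L * (ε * (M + 2 * k * M))) + (K + K) * (ε * (2 * k * M)) := by gcongr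
      _ = M * ((lam * (L * (1 + 2 * k)) + (K + K) * (2 * k)) * ε) := by ring
      _ ≤ M * (lam * (η / 3)) := by gcongr
  have hvar : M * ((b - a) / 2) ^ 2 * lam ^ 2 / 2 ≤ M * (lam * (η / 3)) :=
    calc M * ((b - a) / 2) ^ 2 * lam ^ 2 / 2 = M * lam * (((b - a) / 2) ^ 2 / 2 * lam) := by ring
      _ ≤ M * lam * (η / 3) := by gcongr
      _ = M * (lam * (η / 3)) := by ring
  rw [← sub_le_iff_le_add']
  refine le_of_mul_le_mul_left ?_ (mul_pos hlam hM)
  linarith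

theorem tendsto_integral_firstCoords_of_lipschitzWith (hf : IsSqLogLipschitz K f)
    (hfE : IsUnitEnergyDensity f) (hk : 1 ≤ k) {g : (Fin k → ℝ) → ℝ} {L : ℝ≥0}
    (hL : LipschitzWith L g) {a b : ℝ} (hgab : ∀ z, g z ∈ Set.Icc a b) :
    Tendsto (fun N : ℕ => ∫ v, g (firstCoords k N v) ∂(densityMeasure N (condTensor f N))) atTop
      (𝓝 (∫ z, g z ∂(Measure.pi fun _ : Fin k => lineMeasure f))) := by
  refine Metric.tendsto_nhds.mpr fun η hη => ?_
  filter_upwards [eventually_integral_firstCoords_le hf hfE hk hL hgab (half_pos hη),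
    eventually_integral_firstCoords_le hf hfE hk hL.neg
      (fun z => ⟨neg_le_neg (hgab z).2, neg_le_neg (hgab z).1⟩) (half_pos hη)] with N hle hge
  simp only [Pi.neg_apply, integral_neg] at hge
  rw [Real.dist_eq, abs_lt]
  constructor <;> linarith

theorem tendsto_integral_firstCoords (hf : IsSqLogLipschitz K f) (hfE : IsUnitEnergyDensity f)
    (hk : 1 ≤ k) (χ : (Fin k → ℝ) →ᵇ ℝ) :
    Tendsto (fun N : ℕ => ∫ v, χ (firstCoords k N v) ∂(densityMeasure N (condTensor f N))) atTop
      (𝓝 (∫ z, χ z ∂(Measure.pi fun _ : Fin k => lineMeasure f))) := by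
  have := hfE.isProbabilityMeasure_lineMeasure
  have (N : ℕ) := isProbabilityMeasure_densityMeasure (N := N + 1) hf.continuous hf.pos
  have hmeas (N : ℕ) := (continuous_firstCoords k (N + 1)).measurable.aemeasurable
    (μ := densityMeasure (N + 1) (condTensor f (N + 1)))
  set marginal : ℕ → ProbabilityMeasure (Fin k → ℝ) := fun N =>
    ⟨Measure.map (firstCoords k (N + 1)) (densityMeasure (N + 1) (condTensor f (N + 1))),
      Measure.isProbabilityMeasure_map (hmeas N)⟩
  have hmarginal {g : (Fin k → ℝ) → ℝ} (hg : Continuous g) (N : ℕ) :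
      ∫ z, g z ∂(marginal N : Measure (Fin k → ℝ)) = ∫ v, g (firstCoords k (N + 1) v)
        ∂(densityMeasure (N + 1) (condTensor f (N + 1))) :=
    integral_map (hmeas N) hg.aestronglyMeasurable
  set μ : ProbabilityMeasure (Fin k → ℝ) := ⟨Measure.pi fun _ => lineMeasure f, inferInstance⟩
  have hweak : Tendsto marginal atTop (𝓝 μ) := by
    rw [tendsto_iff_forall_lipschitz_integral_tendsto]
    rintro g ⟨C, hC⟩ ⟨L, hL⟩
    simp only [hmarginal hL.continuous]
    have hbound (z : Fin k → ℝ) : g z ∈ Set.Icc (g 0 - C) (g 0 + C) :=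
      abs_sub_le_iff.mp (hC z 0) |> fun h => ⟨by linarith [h.2], by linarith [h.1]⟩
    exact (tendsto_integral_firstCoords_of_lipschitzWith hf hfE hk hL hbound).comp
      (tendsto_add_atTop_nat 1)
  have h := ProbabilityMeasure.tendsto_iff_forall_integral_tendsto.mp hweak χ
  simp only [hmarginal χ.continuous] at h
  exact (tendsto_add_atTop_iff_nat (f := fun N : ℕ =>
    ∫ v, χ (firstCoords k N v) ∂(densityMeasure N (condTensor f N))) 1).mp h

theorem isChaotic_condTensor (hf : IsSqLogLipschitz K f) (hfE : IsUnitEnergyDensity f) :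
    IsChaotic (lineMeasure f) fun N => densityMeasure N (condTensor f N) :=
  ⟨fun _ hN => have : NeZero _ := ⟨Nat.one_le_iff_ne_zero.mp hN⟩
    isProbabilityMeasure_densityMeasure hf.continuous hf.pos,
    fun _ _ => map_permute_densityMeasure hf.continuous,
    fun _ => tendsto_integral_firstCoords hf hfE⟩

end Chaos

section QuadraticGrowth

variable {k N : ℕ} {K : ℝ≥0} {f : ℝ → ℝ}

theorem integral_sq_densityMeasure (hf : Continuous f) (hpos : ∀ v, 0 < f v) (i : Fin N) :
    ∫ v : KacSphere N, v.1 i ^ 2 ∂(densityMeasure N (condTensor f N)) = 1 := by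
  have : NeZero N := ⟨i.pos.ne'⟩
  have := isProbabilityMeasure_densityMeasure (N := N) hf hpos
  have hexchange (j : Fin N) : ∫ v : KacSphere N, v.1 j ^ 2 ∂(densityMeasure N (condTensor f N)) =
      ∫ v : KacSphere N, v.1 i ^ 2 ∂(densityMeasure N (condTensor f N)) := by
    have hcoord (l : Fin N) := integral_comp_coords hf i.pos (e := fun _ : Fin 1 => l)
      (Function.injective_of_subsingleton _) (g := fun z => z 0 ^ 2) (by fun_prop)
    exact (hcoord j).trans (hcoord i).symm
  have hsum : ∑ j, ∫ v : KacSphere N, v.1 j ^ 2 ∂(densityMeasure N (condTensor f N)) = N := by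
    rw [← integral_finsetSum _ fun j _ =>
      integrable_densityMeasure_of_continuous hf hpos (by fun_prop)]
    simp only [sum_sq_eq, integral_const, probReal_univ, one_smul]
  simp only [hexchange, Finset.sum_const, Finset.card_univ, Fintype.card_fin, nsmul_eq_mul] at hsum
  exact mul_left_cancel₀ (NeZero.ne (N : ℝ)) (hsum.trans (mul_one _).symm)

theorem integral_sum_sq_firstCoords [NeZero N] (hf : Continuous f) (hpos : ∀ v, 0 < f v)
    (hk : k ≤ N) :
    ∫ v, ∑ j, firstCoords k N v j ^ 2 ∂(densityMeasure N (condTensor f N)) = k := by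
  simp only [firstCoords_eq hk]
  rw [integral_finsetSum _ fun j _ =>
    integrable_densityMeasure_of_continuous hf hpos (by fun_prop)]
  simp only [integral_sq_densityMeasure hf hpos, Finset.sum_const, Finset.card_univ,
    Fintype.card_fin, nsmul_eq_mul, mul_one]

theorem exists_lt_integral_min {α : Type*} [MeasurableSpace α] {μ : Measure α} {h : α → ℝ}
    (hh : Integrable h μ) (h0 : ∀ z, 0 ≤ h z) {c : ℝ} (hc : c < ∫ z, h z ∂μ) :
    ∃ n : ℕ, c < ∫ z, min (h z) n ∂μ := by
  have hlim : Tendsto (fun n : ℕ => ∫ z, min (h z) n ∂μ) atTop (𝓝 (∫ z, h z ∂μ)) := by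
    refine tendsto_integral_of_dominated_convergence h
      (fun n => hh.aestronglyMeasurable.inf aestronglyMeasurable_const) hh
      (fun n => ae_of_all _ fun z => ?_) (ae_of_all _ fun z => ?_)
    · rw [Real.norm_of_nonneg (le_min (h0 z) n.cast_nonneg)]
      exact min_le_left _ _
    · refine tendsto_const_nhds.congr' ?_
      filter_upwards [eventually_ge_atTop ⌈h z⌉₊] with n hn
      exact (min_eq_left (Nat.ceil_le.mp hn)).symm
  exact (hlim.eventually_const_lt hc).exists

theorem eventually_lt_integral_firstCoords_of_nonneg (hf : IsSqLogLipschitz K f)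
    (hfE : IsUnitEnergyDensity f) (hk : 1 ≤ k) {h : (Fin k → ℝ) → ℝ} (hh : Continuous h)
    (h0 : ∀ z, 0 ≤ h z) (hint : Integrable h (Measure.pi fun _ => lineMeasure f)) {c : ℝ}
    (hc : c < ∫ z, h z ∂(Measure.pi fun _ => lineMeasure f)) :
    ∀ᶠ N : ℕ in atTop, c < ∫ v, h (firstCoords k N v) ∂(densityMeasure N (condTensor f N)) := by
  obtain ⟨n, hn⟩ := exists_lt_integral_min hint h0 hc
  set χ : (Fin k → ℝ) →ᵇ ℝ := BoundedContinuousFunction.ofNormedAddCommGroup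
    (fun z => min (h z) n) (by fun_prop) n fun z => by
      rw [Real.norm_of_nonneg (le_min (h0 z) n.cast_nonneg)]
      exact min_le_right _ _
  filter_upwards [(tendsto_integral_firstCoords hf hfE hk χ).eventually_const_lt hn,
    eventually_ge_atTop 1] with N hN hN1
  have : NeZero N := ⟨by omega⟩
  have hfirst := continuous_firstCoords k N
  exact hN.trans_le (integral_mono
    (integrable_densityMeasure_of_continuous hf.continuous hf.pos (by fun_prop))
    (integrable_densityMeasure_of_continuous hf.continuous hf.pos (by fun_prop))
    fun v => min_le_left _ _)

/-- Continuous functions dominated by the energy. The sphere fixes the energy, so that no second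
moment escapes to infinity and the chaotic limit extends to these functions. -/
structure HasQuadraticGrowth (g : (Fin k → ℝ) → ℝ) : Prop where
  continuous : Continuous g
  exists_abs_le : ∃ C, ∀ z, |g z| ≤ C * (1 + ∑ j, z j ^ 2)

variable {g : (Fin k → ℝ) → ℝ}

theorem HasQuadraticGrowth.neg (hg : HasQuadraticGrowth g) : HasQuadraticGrowth fun z => -g z :=
  ⟨hg.continuous.neg, by simpa only [abs_neg] using hg.exists_abs_le⟩

theorem IsUnitEnergyDensity.integrable_one_add_sum_sq (hfE : IsUnitEnergyDensity f) (C : ℝ) :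
    Integrable (fun z : Fin k → ℝ => C * (1 + ∑ j, z j ^ 2))
      (Measure.pi fun _ => lineMeasure f) := by
  have := hfE.isProbabilityMeasure_lineMeasure
  exact ((integrable_const 1).add (hfE.integrable_sum_sq k)).const_mul C

theorem HasQuadraticGrowth.integrable (hg : HasQuadraticGrowth g) (hfE : IsUnitEnergyDensity f) :
    Integrable g (Measure.pi fun _ => lineMeasure f) := by
  obtain ⟨C, hC⟩ := hg.exists_abs_le
  exact (hfE.integrable_one_add_sum_sq C).mono' hg.continuous.aestronglyMeasurable
    (ae_of_all _ hC)

theorem eventually_lt_integral_firstCoords (hf : IsSqLogLipschitz K f)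
    (hfE : IsUnitEnergyDensity f) (hk : 1 ≤ k) (hg : HasQuadraticGrowth g) {c : ℝ}
    (hc : c < ∫ z, g z ∂(Measure.pi fun _ => lineMeasure f)) :
    ∀ᶠ N : ℕ in atTop, c < ∫ v, g (firstCoords k N v) ∂(densityMeasure N (condTensor f N)) := by
  have := hfE.isProbabilityMeasure_lineMeasure
  obtain ⟨C, hC⟩ := hg.exists_abs_le
  have hgc := hg.continuous
  set w : (Fin k → ℝ) → ℝ := fun z => C * (1 + ∑ j, z j ^ 2)
  have hwc : Continuous w := by fun_prop
  have hwi := hfE.integrable_one_add_sum_sq (k := k) C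
  have hw : ∫ z, w z ∂(Measure.pi fun _ : Fin k => lineMeasure f) = C * (1 + k) := by
    rw [integral_const_mul, integral_add (integrable_const _) (hfE.integrable_sum_sq k),
      hfE.integral_sum_sq, integral_const, probReal_univ, one_smul]
  have h0 (z : Fin k → ℝ) : 0 ≤ g z + w z := by linarith [hC z, neg_abs_le (g z)]
  have hshift : c + C * (1 + k) <
      ∫ z, (g z + w z) ∂(Measure.pi fun _ : Fin k => lineMeasure f) := by
    rw [integral_add (hg.integrable hfE) hwi, hw]
    exact add_lt_add_left hc _
  filter_upwards [eventually_lt_integral_firstCoords_of_nonneg hf hfE hk (hgc.add hwc) h0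
    ((hg.integrable hfE).add hwi) hshift, eventually_ge_atTop (max k 1)] with N hN hkN
  have : NeZero N := ⟨by omega⟩
  have := isProbabilityMeasure_densityMeasure (N := N) hf.continuous hf.pos
  have hfirst := continuous_firstCoords k N
  have hint {φ : KacSphere N → ℝ} (hφ : Continuous φ) :
      Integrable φ (densityMeasure N (condTensor f N)) :=
    integrable_densityMeasure_of_continuous hf.continuous hf.pos hφ
  have hwN : ∫ v, w (firstCoords k N v) ∂(densityMeasure N (condTensor f N)) = C * (1 + k) := by
    rw [integral_const_mul, integral_add (integrable_const _) (hint (by fun_prop)),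
      integral_sum_sq_firstCoords hf.continuous hf.pos (by omega), integral_const, probReal_univ,
      one_smul]
  simp only [Pi.add_apply] at hN
  rw [integral_add (hint (by fun_prop)) (hint (by fun_prop)), hwN] at hN
  exact lt_of_add_lt_add_right hN

theorem tendsto_integral_firstCoords_of_hasQuadraticGrowth (hf : IsSqLogLipschitz K f)
    (hfE : IsUnitEnergyDensity f) (hk : 1 ≤ k) (hg : HasQuadraticGrowth g) :
    Tendsto (fun N : ℕ => ∫ v, g (firstCoords k N v) ∂(densityMeasure N (condTensor f N))) atTop
      (𝓝 (∫ z, g z ∂(Measure.pi fun _ : Fin k => lineMeasure f))) := by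
  refine tendsto_order.mpr ⟨fun c hc => eventually_lt_integral_firstCoords hf hfE hk hg hc,
    fun c hc => ?_⟩
  have hneg := eventually_lt_integral_firstCoords hf hfE hk hg.neg (c := -c)
    (by rwa [integral_neg, neg_lt_neg_iff])
  simpa only [integral_neg, neg_lt_neg_iff] using hneg

theorem IsSqLogLipschitz.hasQuadraticGrowth_log (hf : IsSqLogLipschitz K f) (i : Fin k) :
    HasQuadraticGrowth fun z : Fin k → ℝ => Real.log (f (z i)) where
  continuous := hf.continuous_log.comp (continuous_apply i)
  exists_abs_le := by
    refine ⟨|Real.log (f 0)| + K, fun z => ?_⟩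
    have hlip := hf.abs_log_sub_log_le (z i) 0
    rw [zero_pow two_ne_zero, sub_zero, abs_sq] at hlip
    have hi : z i ^ 2 ≤ ∑ j, z j ^ 2 :=
      Finset.single_le_sum (f := fun j => z j ^ 2) (fun _ _ => sq_nonneg _) (Finset.mem_univ i)
    calc |Real.log (f (z i))| ≤ |Real.log (f 0)| * 1 + K * z i ^ 2 := by
          linarith [abs_sub_abs_le_abs_sub (Real.log (f (z i))) (Real.log (f 0))]
      _ ≤ |Real.log (f 0)| * (1 + ∑ j, z j ^ 2) + K * (1 + ∑ j, z j ^ 2) := by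
          have : 0 ≤ z i ^ 2 := sq_nonneg _
          gcongr <;> linarith
      _ = (|Real.log (f 0)| + K) * (1 + ∑ j, z j ^ 2) := by ring

end QuadraticGrowth

section Entropy

variable {N : ℕ} {f : ℝ → ℝ}

section FixedDimension

variable [NeZero N]

theorem log_condTensor (hf : Continuous f) (hpos : ∀ v, 0 < f v) (v : KacSphere N) :
    Real.log (condTensor f N v) = ∑ j, Real.log (f (v.1 j)) - Real.log (Z N f) := by
  rw [condTensor, Real.log_div (Finset.prod_pos fun j _ => hpos _).ne' (Z_pos hf hpos).ne',
    Real.log_prod fun j _ => (hpos _).ne']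

theorem continuous_log_condTensor (hf : Continuous f) (hpos : ∀ v, 0 < f v) :
    Continuous fun v => Real.log (condTensor f N v) :=
  (continuous_condTensor hf).log fun v => (condTensor_pos hf hpos v).ne'

theorem entropy_condTensor (hf : Continuous f) (hpos : ∀ v, 0 < f v) :
    entropy N (condTensor f N) = ENNReal.ofReal
      (∫ v, Real.log (condTensor f N v) ∂(densityMeasure N (condTensor f N))) := by
  have := isProbabilityMeasure_densityMeasure (N := N) hf hpos
  have hac : densityMeasure N (condTensor f N) ≪ sigma N := withDensity_absolutelyContinuous _ _
  have hllr : llr (densityMeasure N (condTensor f N)) (sigma N)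
      =ᵐ[densityMeasure N (condTensor f N)] fun v => Real.log (condTensor f N v) := by
    refine hac.ae_le ?_
    filter_upwards [Measure.rnDeriv_withDensity (sigma N)
      (continuous_condTensor hf).measurable.ennreal_ofReal] with v hv
    rw [llr, densityMeasure, hv, ENNReal.toReal_ofReal (condTensor_pos hf hpos v).le]
  rw [entropy, InformationTheory.klDiv_of_ac_of_integrable hac ((integrable_congr hllr).mpr
    (integrable_densityMeasure_of_continuous hf hpos (continuous_log_condTensor hf hpos))),
    integral_congr_ae hllr, probReal_univ, probReal_univ, add_sub_cancel_right]

theorem integral_log_condTensor (hf : Continuous f) (hpos : ∀ v, 0 < f v) :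
    ∫ v, Real.log (condTensor f N v) ∂(densityMeasure N (condTensor f N)) =
      N * ∫ v, Real.log (f (firstCoords 1 N v 0)) ∂(densityMeasure N (condTensor f N)) -
        Real.log (Z N f) := by
  have := isProbabilityMeasure_densityMeasure (N := N) hf hpos
  have hl : Continuous fun v => Real.log (f v) := hf.log fun v => (hpos v).ne'
  have hcoord (j : Fin N) : Continuous fun v : KacSphere N => Real.log (f (v.1 j)) :=
    hl.comp (by fun_prop : Continuous fun v : KacSphere N => v.1 j)
  have hint (j : Fin N) := integrable_densityMeasure_of_continuous hf hpos (hcoord j)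
  have hexchange (j : Fin N) := integral_comp_coords hf (Nat.pos_of_neZero N)
    (e := fun _ : Fin 1 => j) (Function.injective_of_subsingleton _)
    (g := fun z => Real.log (f (z 0))) (hl.comp (continuous_apply 0))
  simp only [log_condTensor hf hpos]
  rw [integral_sub (integrable_finsetSum _ fun j _ => hint j) (integrable_const _),
    integral_finsetSum _ fun j _ => hint j]
  simp only [hexchange, Finset.sum_const, Finset.card_univ, Fintype.card_fin, nsmul_eq_mul,
    integral_const, probReal_univ, one_smul]

end FixedDimension

section NormalizationAsymptotics

variable {K K' : ℝ≥0} {g : ℝ → ℝ}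

theorem eventually_log_Z_sub_log_Z_div_lt (hf : IsSqLogLipschitz K f) (hf1 : ∫ v, f v = 1)
    (hg : IsSqLogLipschitz K' g) (hgE : IsUnitEnergyDensity g) {η : ℝ} (hη : 0 < η) :
    ∀ᶠ N : ℕ in atTop, (Real.log (Z N f) - Real.log (Z N g)) / N < η := by
  obtain ⟨ε, hε, hε_lt⟩ := exists_pos_mul_lt (half_pos hη) (K + K' : ℝ)
  filter_upwards [hgE.eventually_half_le_setLIntegral_shell hε, eventually_ge_atTop 1,
    (tendsto_const_div_atTop_nhds_zero_nat (Real.log 2)).eventually_lt_const (half_pos hη)]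
    with N hmass hN1 hlog2
  have : NeZero N := ⟨by omega⟩
  have hN : (0 : ℝ) < N := Nat.cast_pos.mpr hN1
  have hZ : 0 < Z N g := Z_pos hg.continuous hg.pos
  have hlog := Real.log_le_log (Z_pos hf.continuous hf.pos) (Z_le_mul_Z hf hf1 hg hmass)
  rw [Real.log_mul (by positivity) hZ.ne', Real.log_mul two_ne_zero (Real.exp_pos _).ne',
    Real.log_exp] at hlog
  rw [div_lt_iff₀ hN] at hlog2 ⊢
  have : (K + K') * ε * N < η / 2 * N := by gcongr
  linarith

theorem tendsto_log_Z_sub_log_Z_div (hf : IsSqLogLipschitz K f) (hfE : IsUnitEnergyDensity f)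
    (hg : IsSqLogLipschitz K' g) (hgE : IsUnitEnergyDensity g) :
    Tendsto (fun N : ℕ => (Real.log (Z N f) - Real.log (Z N g)) / N) atTop (𝓝 0) := by
  refine Metric.tendsto_nhds.mpr fun η hη => ?_
  filter_upwards [eventually_log_Z_sub_log_Z_div_lt hf hfE.integral_eq_one hg hgE hη,
    eventually_log_Z_sub_log_Z_div_lt hg hgE.integral_eq_one hf hfE hη] with N hlt hgt
  rw [← neg_sub, neg_div] at hgt
  rw [Real.dist_eq, sub_zero, abs_lt]
  exact ⟨neg_lt.mp hgt, hlt⟩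

end NormalizationAsymptotics

end Entropy

section GaussianDensities

open ProbabilityTheory

variable {a : ℝ≥0}

theorem log_gaussianPDFReal (ha : a ≠ 0) (x : ℝ) :
    Real.log (gaussianPDFReal 0 a x) = -(Real.log (2 * Real.pi * a) / 2) - x ^ 2 / (2 * a) := by
  have : (0 : ℝ) < a := by positivity
  rw [gaussianPDFReal, Real.log_mul (by positivity) (Real.exp_pos _).ne', Real.log_exp,
    Real.log_inv, Real.log_sqrt (by positivity), sub_zero]
  ring

theorem isSqLogLipschitz_gaussianPDFReal (ha : a ≠ 0) :
    IsSqLogLipschitz (2 * a)⁻¹ (gaussianPDFReal 0 a) where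
  pos v := gaussianPDFReal_pos _ _ _ ha
  le_exp_mul x y := by
    have : (0 : ℝ) < a := by positivity
    rw [gaussianPDFReal, gaussianPDFReal, mul_left_comm, ← Real.exp_add]
    gcongr
    push_cast
    rw [sub_zero, sub_zero, ← sub_le_iff_le_add, ← sub_div, ← div_eq_inv_mul]
    gcongr
    linarith [neg_abs_le (x ^ 2 - y ^ 2)]

theorem integrable_gaussianReal_iff (ha : a ≠ 0) {h : ℝ → ℝ} :
    Integrable h (gaussianReal 0 a) ↔ Integrable fun v => h v * gaussianPDFReal 0 a v := by
  rw [gaussianReal_of_var_ne_zero _ ha]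
  exact integrable_withDensity_ofReal_iff (by fun_prop) fun v => gaussianPDFReal_nonneg _ _ v

theorem integral_gaussianReal (ha : a ≠ 0) (h : ℝ → ℝ) :
    ∫ v, h v ∂(gaussianReal 0 a) = ∫ v, h v * gaussianPDFReal 0 a v := by
  rw [gaussianReal_of_var_ne_zero _ ha]
  exact integral_withDensity_ofReal (by fun_prop) (fun v => gaussianPDFReal_nonneg _ _ v) h

theorem integrable_abs_pow_gaussianReal (a : ℝ≥0) (k : ℕ) :
    Integrable (fun v => |v| ^ k) (gaussianReal 0 a) := by
  simpa only [id_eq, Real.norm_eq_abs] using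
    (memLp_id_gaussianReal (μ := 0) (v := a) k).integrable_norm_pow'

theorem integrable_pow_gaussianReal (a : ℝ≥0) (k : ℕ) :
    Integrable (fun v => v ^ k) (gaussianReal 0 a) :=
  (integrable_abs_pow_gaussianReal a k).mono (by fun_prop) (ae_of_all _ fun v => by simp)

theorem integral_sq_gaussianReal (a : ℝ≥0) : ∫ v, v ^ 2 ∂(gaussianReal 0 a) = a := by
  have h := variance_of_integral_eq_zero (μ := gaussianReal 0 a) (X := id) aemeasurable_id
    (by simp)
  rw [variance_id_gaussianReal] at h
  exact h.symm

theorem isUnitEnergyDensity_gaussianPDFReal : IsUnitEnergyDensity (gaussianPDFReal 0 1) where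
  measurable := by fun_prop
  nonneg := gaussianPDFReal_nonneg _ _
  integral_eq_one := integral_gaussianPDFReal_eq_one 0 one_ne_zero
  integral_sq_mul_eq_one := by
    rw [← integral_gaussianReal one_ne_zero, integral_sq_gaussianReal, NNReal.coe_one]
  integrable_pow_four_mul :=
    (integrable_gaussianReal_iff one_ne_zero).mp (integrable_pow_gaussianReal 1 4)

theorem log_Z_gaussianPDFReal {N : ℕ} [NeZero N] :
    Real.log (Z N (gaussianPDFReal 0 1)) = -(N * ((Real.log (2 * Real.pi) + 1) / 2)) := by
  have hpos (x : ℝ) := gaussianPDFReal_pos 0 1 x one_ne_zero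
  have hconst (v : KacSphere N) : ∏ j, gaussianPDFReal 0 1 (v.1 j) =
      Real.exp (-(N * ((Real.log (2 * Real.pi) + 1) / 2))) := by
    rw [← Real.exp_log (Finset.prod_pos fun j _ => hpos (v.1 j)),
      Real.log_prod fun j _ => (hpos _).ne']
    simp only [log_gaussianPDFReal one_ne_zero, NNReal.coe_one, mul_one]
    rw [Finset.sum_sub_distrib, ← Finset.sum_div, sum_sq_eq, Finset.sum_const, Finset.card_univ,
      Fintype.card_fin, nsmul_eq_mul]
    ring_nf
  simp only [Z, hconst, integral_const, probReal_univ, one_smul, Real.log_exp]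

end GaussianDensities

section EntropyPerParticle

variable {K : ℝ≥0} {f : ℝ → ℝ}

/-- The relative entropy of a unit-energy density with respect to the standard Gaussian; it is the
limit of `H_N / N` along the conditioned tensor products of `f`. -/
def gaussianEntropy (f : ℝ → ℝ) : ℝ :=
  ∫ v, Real.log (f v) ∂(lineMeasure f) + (Real.log (2 * Real.pi) + 1) / 2

theorem tendsto_log_Z_div (hf : IsSqLogLipschitz K f) (hfE : IsUnitEnergyDensity f) :
    Tendsto (fun N : ℕ => Real.log (Z N f) / N) atTop
      (𝓝 (-((Real.log (2 * Real.pi) + 1) / 2))) := by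
  have hlim := (tendsto_log_Z_sub_log_Z_div hf hfE (isSqLogLipschitz_gaussianPDFReal one_ne_zero)
    isUnitEnergyDensity_gaussianPDFReal).add_const (-((Real.log (2 * Real.pi) + 1) / 2))
  rw [zero_add] at hlim
  refine hlim.congr' ?_
  filter_upwards [eventually_ge_atTop 1] with N hN
  have : NeZero N := ⟨by omega⟩
  have hN0 : (N : ℝ) ≠ 0 := NeZero.ne _
  rw [log_Z_gaussianPDFReal]
  field_simp
  ring

theorem tendsto_integral_log_condTensor_div (hf : IsSqLogLipschitz K f)
    (hfE : IsUnitEnergyDensity f) :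
    Tendsto (fun N : ℕ =>
      (∫ v, Real.log (condTensor f N v) ∂(densityMeasure N (condTensor f N))) / N) atTop
      (𝓝 (gaussianEntropy f)) := by
  have := hfE.isProbabilityMeasure_lineMeasure
  have hone : ∫ z : Fin 1 → ℝ, Real.log (f (z 0)) ∂(Measure.pi fun _ => lineMeasure f) =
      ∫ v, Real.log (f v) ∂(lineMeasure f) :=
    integral_comp_eval (μ := fun _ : Fin 1 => lineMeasure f) (f := fun v => Real.log (f v))
      hf.continuous_log.aestronglyMeasurable
  have hlim := (tendsto_integral_firstCoords_of_hasQuadraticGrowth hf hfE le_rfl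
    (hf.hasQuadraticGrowth_log 0)).sub (tendsto_log_Z_div hf hfE)
  rw [hone, sub_neg_eq_add] at hlim
  refine hlim.congr' ?_
  filter_upwards [eventually_ge_atTop 1] with N hN
  have : NeZero N := ⟨by omega⟩
  have hN0 : (N : ℝ) ≠ 0 := NeZero.ne _
  rw [integral_log_condTensor hf.continuous hf.pos, sub_div, mul_div_cancel_left₀ _ hN0]

end EntropyPerParticle

section Collisions

variable {N : ℕ}

theorem rotVec_rotVec_neg {i j : Fin N} (hij : i ≠ j) (θ : ℝ) (v : EuclideanSpace ℝ (Fin N)) :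
    rotVec i j θ (rotVec i j (-θ) v) = v := by
  ext k
  simp only [rotVec, Real.cos_neg, Real.sin_neg, if_true, if_neg hij.symm]
  split_ifs with hi hj
  · subst hi
    linear_combination v k * Real.sin_sq_add_cos_sq θ
  · subst hj
    linear_combination v k * Real.sin_sq_add_cos_sq θ
  · rfl

/-- The rotation `R_{i,j,θ}` as a linear isometry, through which it preserves `σ^N`. -/
def rotIso {i j : Fin N} (hij : i ≠ j) (θ : ℝ) :
    EuclideanSpace ℝ (Fin N) ≃ₗᵢ[ℝ] EuclideanSpace ℝ (Fin N) where
  toFun := rotVec i j θ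
  invFun := rotVec i j (-θ)
  map_add' x y := by
    ext k
    simp only [rotVec, PiLp.add_apply]
    split_ifs <;> ring
  map_smul' c x := by
    ext k
    simp only [rotVec, PiLp.smul_apply, smul_eq_mul, RingHom.id_apply]
    split_ifs <;> ring
  left_inv x := by simpa only [neg_neg] using rotVec_rotVec_neg hij (-θ) x
  right_inv := rotVec_rotVec_neg hij θ
  norm_map' := norm_rotVec hij θ

variable (p : {p : Fin N × Fin N // p.1 < p.2})

theorem rot_rot_neg (θ : ℝ) (v : KacSphere N) : rot p θ (rot p (-θ) v) = v :=
  Subtype.ext (rotVec_rotVec_neg p.2.ne θ v)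

theorem measurePreserving_rot (θ : ℝ) : MeasurePreserving (rot p θ) (sigma N) (sigma N) :=
  measurePreserving_sphereMap_sigma (rotIso p.2.ne θ)

theorem integral_comp_rot (θ : ℝ) {h : KacSphere N → ℝ} (hh : Continuous h) :
    ∫ v, h (rot p θ v) ∂(sigma N) = ∫ v, h v ∂(sigma N) := by
  have hrot := measurePreserving_rot p θ
  rw [← integral_map hrot.measurable.aemeasurable hh.aestronglyMeasurable, hrot.map_eq]

theorem continuous_rot : Continuous fun q : KacSphere N × ℝ => rot p q.2 q.1 := by
  refine Continuous.subtype_mk ((PiLp.continuous_toLp 2 _).comp (continuous_pi fun k => ?_)) _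
  split_ifs <;> fun_prop

theorem integral_intervalIntegral_swap {X : Type*} [TopologicalSpace X] [CompactSpace X]
    [T2Space X] [SecondCountableTopology X] [MeasurableSpace X] [OpensMeasurableSpace X]
    (μ : Measure X) [IsFiniteMeasure μ] {h : X → ℝ → ℝ} (hh : Continuous (Function.uncurry h))
    (a b : ℝ) :
    ∫ x, (∫ θ in a..b, h x θ) ∂μ = ∫ θ in a..b, (∫ x, h x θ ∂μ) := by
  refine (intervalIntegral_integral_swap (f := fun θ x => h x θ) ?_).symm
  have hc : Continuous (Function.uncurry fun θ x => h x θ) := hh.comp continuous_swap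
  have hcomp : IsCompact (Set.uIcc a b ×ˢ (Set.univ : Set X)) :=
    isCompact_uIcc.prod isCompact_univ
  have hint := (hc.continuousOn.integrableOn_compact (μ := volume.prod μ) hcomp).mono_set
    (Set.prod_mono_left Set.uIoc_subset_uIcc)
  rwa [IntegrableOn, ← Measure.prod_restrict, Measure.restrict_univ] at hint

/-- The average of `φ` over all collisions of the pair `p`; `Q_N` is the mean of these operators
over all pairs. -/
def angularAverage (φ : KacSphere N → ℝ) (v : KacSphere N) : ℝ :=
  (2 * Real.pi)⁻¹ * ∫ θ in (0 : ℝ)..(2 * Real.pi), φ (rot p θ v)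

variable {φ ψ : KacSphere N → ℝ}

theorem Q_eq_sum_angularAverage (φ : KacSphere N → ℝ) (v : KacSphere N) :
    Q N φ v = (N.choose 2 : ℝ)⁻¹ *
      ∑ p : {p : Fin N × Fin N // p.1 < p.2}, angularAverage p φ v := rfl

theorem continuous_angularAverage (hφ : Continuous φ) : Continuous (angularAverage p φ) :=
  continuous_const.mul <|
    intervalIntegral.continuous_parametric_intervalIntegral_of_continuous'
      (f := fun (v : KacSphere N) θ => φ (rot p θ v)) (hφ.comp (continuous_rot p)) _ _

theorem continuous_Q (hφ : Continuous φ) : Continuous (Q N φ) :=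
  continuous_const.mul <| continuous_finsetSum _ fun p _ => continuous_angularAverage p hφ

theorem integral_mul_angularAverage (hψ : Continuous ψ) (hφ : Continuous φ) :
    ∫ v, ψ v * angularAverage p φ v ∂(sigma N) = (2 * Real.pi)⁻¹ *
      ∫ θ in (0 : ℝ)..(2 * Real.pi), ∫ v, ψ v * φ (rot p θ v) ∂(sigma N) := by
  have hcont : Continuous (Function.uncurry fun (v : KacSphere N) θ => ψ v * φ (rot p θ v)) :=
    (hψ.comp continuous_fst).mul (hφ.comp (continuous_rot p))
  rw [← integral_intervalIntegral_swap _ hcont, ← integral_const_mul]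
  refine integral_congr_ae (ae_of_all _ fun v => ?_)
  simp only [angularAverage, intervalIntegral.integral_const_mul, mul_left_comm]

theorem card_pairs (N : ℕ) : Fintype.card {p : Fin N × Fin N // p.1 < p.2} = N.choose 2 := by
  have e : {p : Fin N × Fin N // p.1 < p.2} ≃ Σ j : Fin N, Set.Iio j :=
    { toFun := fun p => ⟨p.1.2, p.1.1, p.2⟩
      invFun := fun q => ⟨(q.2.1, q.1), q.2.2⟩
      left_inv := fun _ => rfl
      right_inv := fun _ => rfl }
  rw [Fintype.card_congr e, Fintype.card_sigma, Nat.choose_two_right, ← Finset.sum_range_id,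
    ← Fin.sum_univ_eq_sum_range fun i => i]
  simp only [Fintype.card_Iio, Fin.card_Iio]

theorem integral_mul_Q (hN : 2 ≤ N) (hψ : Continuous ψ) (hφ : Continuous φ) {c : ℝ}
    (hc : ∀ p, ∫ v, ψ v * angularAverage p φ v ∂(sigma N) = c) :
    ∫ v, ψ v * Q N φ v ∂(sigma N) = c := by
  have hchoose : (N.choose 2 : ℝ) ≠ 0 := Nat.cast_ne_zero.mpr (Nat.choose_pos hN).ne'
  have hQ (v : KacSphere N) : ψ v * Q N φ v = (N.choose 2 : ℝ)⁻¹ *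
      ∑ p : {p : Fin N × Fin N // p.1 < p.2}, ψ v * angularAverage p φ v := by
    rw [Q_eq_sum_angularAverage, mul_left_comm, Finset.mul_sum]
  have hint (p : {p : Fin N × Fin N // p.1 < p.2}) :
      Integrable (fun v => ψ v * angularAverage p φ v) (sigma N) :=
    integrable_of_continuous (hψ.mul (continuous_angularAverage p hφ))
  simp only [hQ, integral_const_mul]
  rw [integral_finsetSum _ fun p _ => hint p]
  simp only [hc, Finset.sum_const, Finset.card_univ, card_pairs, nsmul_eq_mul]
  exact inv_mul_cancel_left₀ hchoose c

end Collisions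

section EntropyProduction

/-- The loss of `log f ⊗ f` in a collision through the angle `-θ` of two particles with velocities
`x` and `y`. -/
def collisionLoss (f : ℝ → ℝ) (x y θ : ℝ) : ℝ :=
  Real.log (f x) + Real.log (f y) - Real.log (f (Real.cos θ * x + Real.sin θ * y)) -
    Real.log (f (-Real.sin θ * x + Real.cos θ * y))

/-- The average of `collisionLoss` over the scattering angle. Its mean under `f ⊗ f` is the limit
of the entropy production per particle along the conditioned tensor products of `f`. -/
def meanCollisionLoss (f : ℝ → ℝ) (z : Fin 2 → ℝ) : ℝ :=
  (2 * Real.pi)⁻¹ * ∫ θ in (0 : ℝ)..(2 * Real.pi), collisionLoss f (z 0) (z 1) θ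

variable {f : ℝ → ℝ} {K : ℝ≥0} {N : ℕ}

theorem sq_add_sq_rotate (x y θ : ℝ) :
    (Real.cos θ * x + Real.sin θ * y) ^ 2 + (-Real.sin θ * x + Real.cos θ * y) ^ 2 =
      x ^ 2 + y ^ 2 := by
  linear_combination (x ^ 2 + y ^ 2) * Real.sin_sq_add_cos_sq θ

theorem continuous_collisionLoss (hf : Continuous f) (hpos : ∀ v, 0 < f v) :
    Continuous fun q : (ℝ × ℝ) × ℝ => collisionLoss f q.1.1 q.1.2 q.2 := by
  have hlog : Continuous fun v => Real.log (f v) := hf.log fun v => (hpos v).ne'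
  unfold collisionLoss
  exact (((hlog.comp (by fun_prop)).add (hlog.comp (by fun_prop))).sub
    (hlog.comp (by fun_prop))).sub (hlog.comp (by fun_prop))

theorem continuous_collisionLoss_comp {X : Type*} [TopologicalSpace X] (hf : Continuous f)
    (hpos : ∀ v, 0 < f v) {x y θ : X → ℝ} (hx : Continuous x) (hy : Continuous y)
    (hθ : Continuous θ) : Continuous fun q => collisionLoss f (x q) (y q) (θ q) :=
  (continuous_collisionLoss hf hpos).comp ((hx.prodMk hy).prodMk hθ)

theorem abs_collisionLoss_le (hf : IsSqLogLipschitz K f) (x y θ : ℝ) :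
    |collisionLoss f x y θ| ≤ 2 * K * (x ^ 2 + y ^ 2) := by
  set x' := Real.cos θ * x + Real.sin θ * y
  set y' := -Real.sin θ * x + Real.cos θ * y
  have henergy : x' ^ 2 + y' ^ 2 = x ^ 2 + y ^ 2 := sq_add_sq_rotate x y θ
  have hx : |x ^ 2 - x' ^ 2| ≤ x ^ 2 + y ^ 2 :=
    abs_sub_le_iff.mpr ⟨by nlinarith, by nlinarith⟩
  have hy : |y ^ 2 - y' ^ 2| ≤ x ^ 2 + y ^ 2 :=
    abs_sub_le_iff.mpr ⟨by nlinarith, by nlinarith⟩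
  calc |collisionLoss f x y θ|
      = |(Real.log (f x) - Real.log (f x')) + (Real.log (f y) - Real.log (f y'))| := by
        rw [collisionLoss]
        congr 1
        ring
    _ ≤ K * |x ^ 2 - x' ^ 2| + K * |y ^ 2 - y' ^ 2| :=
        (abs_add_le _ _).trans (add_le_add (hf.abs_log_sub_log_le x x')
          (hf.abs_log_sub_log_le y y'))
    _ ≤ K * (x ^ 2 + y ^ 2) + K * (x ^ 2 + y ^ 2) := by gcongr
    _ = 2 * K * (x ^ 2 + y ^ 2) := by ring

theorem hasQuadraticGrowth_meanCollisionLoss (hf : IsSqLogLipschitz K f) :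
    HasQuadraticGrowth (meanCollisionLoss f) where
  continuous := continuous_const.mul <|
    intervalIntegral.continuous_parametric_intervalIntegral_of_continuous'
      (f := fun (z : Fin 2 → ℝ) θ => collisionLoss f (z 0) (z 1) θ)
      (continuous_collisionLoss_comp hf.continuous hf.pos (by fun_prop) (by fun_prop)
        (by fun_prop)) _ _
  exists_abs_le := by
    refine ⟨2 * K, fun z => ?_⟩
    have hpi := Real.two_pi_pos
    have hint := intervalIntegral.norm_integral_le_of_norm_le_const (a := 0) (b := 2 * Real.pi)
      (f := fun θ => collisionLoss f (z 0) (z 1) θ)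
      fun θ _ => abs_collisionLoss_le hf (z 0) (z 1) θ
    rw [meanCollisionLoss, abs_mul, abs_of_pos (inv_pos.mpr hpi), inv_mul_le_iff₀ hpi,
      Fin.sum_univ_two]
    rw [sub_zero, abs_of_pos hpi, mul_comm _ (2 * Real.pi), Real.norm_eq_abs] at hint
    refine hint.trans (mul_le_mul_of_nonneg_left ?_ hpi.le)
    exact mul_le_mul_of_nonneg_left (by linarith) (by positivity)

theorem sum_comp_rot_neg (g : ℝ → ℝ) (p : {p : Fin N × Fin N // p.1 < p.2}) (θ : ℝ)
    (v : KacSphere N) :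
    ∑ k, g ((rot p (-θ) v).1 k) = ∑ k, g (v.1 k) - (g (v.1 p.1.1) + g (v.1 p.1.2) -
      g (Real.cos θ * v.1 p.1.1 + Real.sin θ * v.1 p.1.2) -
      g (-Real.sin θ * v.1 p.1.1 + Real.cos θ * v.1 p.1.2)) := by
  obtain ⟨⟨i, j⟩, hij⟩ := p
  have hji : j ≠ i := hij.ne'
  have hsplit (h : Fin N → ℝ) :
      ∑ k, h k = h i + (h j + ∑ k ∈ (Finset.univ.erase i).erase j, h k) := by
    rw [Finset.add_sum_erase _ _ (Finset.mem_erase.mpr ⟨hji, Finset.mem_univ j⟩),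
      Finset.add_sum_erase _ _ (Finset.mem_univ i)]
  have hrest : ∑ k ∈ (Finset.univ.erase i).erase j, g ((rot ⟨(i, j), hij⟩ (-θ) v).1 k) =
      ∑ k ∈ (Finset.univ.erase i).erase j, g (v.1 k) :=
    Finset.sum_congr rfl fun k hk => by
      have hkj : k ≠ j := Finset.ne_of_mem_erase hk
      have hki : k ≠ i := Finset.ne_of_mem_erase (Finset.mem_of_mem_erase hk)
      simp only [rot, rotVec, if_neg hkj, if_neg hki]
  rw [hsplit, hsplit fun k => g (v.1 k), hrest]
  simp only [rot, rotVec, if_true, if_neg hji, Real.cos_neg, Real.sin_neg, neg_mul,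
    sub_neg_eq_add]
  ring

section FixedDimension

variable (hf : Continuous f) (hpos : ∀ v, 0 < f v)

include hf hpos

theorem log_condTensor_rot_neg [NeZero N] (p : {p : Fin N × Fin N // p.1 < p.2}) (θ : ℝ)
    (v : KacSphere N) :
    Real.log (condTensor f N (rot p (-θ) v)) =
      Real.log (condTensor f N v) - collisionLoss f (v.1 p.1.1) (v.1 p.1.2) θ := by
  rw [log_condTensor hf hpos, log_condTensor hf hpos, sum_comp_rot_neg (fun x => Real.log (f x)),
    collisionLoss]
  ring

theorem integral_collisionLoss_pair (hN : 2 ≤ N) {i j : Fin N} (hij : i ≠ j) (θ : ℝ) :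
    ∫ v : KacSphere N, collisionLoss f (v.1 i) (v.1 j) θ ∂(densityMeasure N (condTensor f N)) =
      ∫ v, collisionLoss f (firstCoords 2 N v 0) (firstCoords 2 N v 1) θ
        ∂(densityMeasure N (condTensor f N)) := by
  have hinj : Function.Injective ![i, j] := by
    simp [Function.Injective, Fin.forall_fin_two, hij, hij.symm]
  exact integral_comp_coords hf hN hinj (g := fun z => collisionLoss f (z 0) (z 1) θ)
    (continuous_collisionLoss_comp hf hpos (by fun_prop) (by fun_prop) (by fun_prop))

/-- The invariance of `σ^N` moves the rotation from `F` to `log F`. -/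
theorem integral_log_condTensor_mul_rot (hN : 2 ≤ N) (p : {p : Fin N × Fin N // p.1 < p.2})
    (θ : ℝ) :
    ∫ v, Real.log (condTensor f N v) * condTensor f N (rot p θ v) ∂(sigma N) =
      ∫ v, (Real.log (condTensor f N v) -
        collisionLoss f (firstCoords 2 N v 0) (firstCoords 2 N v 1) θ)
        ∂(densityMeasure N (condTensor f N)) := by
  have : NeZero N := ⟨by omega⟩
  have hlog := continuous_log_condTensor (N := N) hf hpos
  have hfirst := continuous_firstCoords 2 N
  have hrot : Continuous fun v : KacSphere N => condTensor f N (rot p θ v) :=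
    ((continuous_condTensor hf).comp (continuous_rot p)).comp (f := fun v => (v, θ)) (by fun_prop)
  have hprod : Continuous fun v : KacSphere N =>
    Real.log (condTensor f N v) * condTensor f N (rot p θ v) := hlog.mul hrot
  have hint {x y : KacSphere N → ℝ} (hx : Continuous x) (hy : Continuous y) :
      Integrable (fun v => collisionLoss f (x v) (y v) θ) (densityMeasure N (condTensor f N)) :=
    integrable_densityMeasure_of_continuous hf hpos
      (continuous_collisionLoss_comp hf hpos hx hy continuous_const)
  have hlog_int := integrable_densityMeasure_of_continuous hf hpos hlog
  rw [integral_sub hlog_int (hint (by fun_prop) (by fun_prop)),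
    ← integral_collisionLoss_pair hf hpos hN p.2.ne θ,
    ← integral_sub hlog_int (hint (by fun_prop) (by fun_prop)), integral_densityMeasure hf hpos,
    ← integral_comp_rot p (-θ) hprod]
  simp only [rot_rot_neg, log_condTensor_rot_neg hf hpos]

theorem integral_log_condTensor_mul_angularAverage (hN : 2 ≤ N)
    (p : {p : Fin N × Fin N // p.1 < p.2}) :
    ∫ v, Real.log (condTensor f N v) * angularAverage p (condTensor f N) v ∂(sigma N) =
      ∫ v, (Real.log (condTensor f N v) - meanCollisionLoss f (firstCoords 2 N v))
        ∂(densityMeasure N (condTensor f N)) := by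
  have : NeZero N := ⟨by omega⟩
  have := isProbabilityMeasure_densityMeasure (N := N) hf hpos
  have hlog := continuous_log_condTensor (N := N) hf hpos
  have hfirst := continuous_firstCoords 2 N
  have hcont : Continuous (Function.uncurry fun (v : KacSphere N) θ =>
      Real.log (condTensor f N v) -
        collisionLoss f (firstCoords 2 N v 0) (firstCoords 2 N v 1) θ) :=
    (hlog.comp continuous_fst).sub
      (continuous_collisionLoss_comp hf hpos (by fun_prop) (by fun_prop) (by fun_prop))
  rw [integral_mul_angularAverage p hlog (continuous_condTensor hf)]
  simp only [integral_log_condTensor_mul_rot hf hpos hN]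
  rw [← integral_intervalIntegral_swap _ hcont, ← integral_const_mul]
  refine integral_congr_ae (ae_of_all _ fun v => ?_)
  have hloss : Continuous fun θ =>
      collisionLoss f (firstCoords 2 N v 0) (firstCoords 2 N v 1) θ :=
    continuous_collisionLoss_comp hf hpos (by fun_prop) (by fun_prop) (by fun_prop)
  simp only [meanCollisionLoss]
  rw [intervalIntegral.integral_sub (by simp) (hloss.intervalIntegrable _ _), mul_sub,
    intervalIntegral.integral_const, smul_eq_mul, sub_zero,
    inv_mul_cancel_left₀ Real.two_pi_pos.ne']

end FixedDimension

theorem entropyProduction_condTensor (hf : IsSqLogLipschitz K f) (hN : 2 ≤ N) :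
    entropyProduction N (condTensor f N) =
      ((N * ∫ v, meanCollisionLoss f (firstCoords 2 N v)
        ∂(densityMeasure N (condTensor f N)) : ℝ) : EReal) := by
  have : NeZero N := ⟨by omega⟩
  have hF := continuous_condTensor (N := N) hf.continuous
  have hlog := continuous_log_condTensor (N := N) hf.continuous hf.pos
  have hL : Continuous (L N (condTensor f N)) := continuous_const.mul ((continuous_Q hF).sub hF)
  have hloss : Continuous fun v => meanCollisionLoss f (firstCoords 2 N v) :=
    (hasQuadraticGrowth_meanCollisionLoss hf).continuous.comp (continuous_firstCoords 2 N)
  rw [entropyProduction, if_pos ⟨ae_of_all _ (condTensor_pos hf.continuous hf.pos),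
    integrable_of_continuous (hlog.mul hL)⟩]
  congr 1
  have hlogQ : Integrable (fun v => Real.log (condTensor f N v) * Q N (condTensor f N) v)
      (sigma N) := integrable_of_continuous (hlog.mul (continuous_Q hF))
  have hlogF : Integrable (fun v => Real.log (condTensor f N v) * condTensor f N v) (sigma N) :=
    integrable_of_continuous (hlog.mul hF)
  simp only [L, mul_left_comm _ (N : ℝ), integral_const_mul]
  simp only [mul_sub]
  rw [integral_sub hlogQ hlogF,
    integral_mul_Q hN hlog hF fun p =>
      integral_log_condTensor_mul_angularAverage hf.continuous hf.pos hN p,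
    integral_sub (integrable_densityMeasure_of_continuous hf.continuous hf.pos hlog)
      (integrable_densityMeasure_of_continuous hf.continuous hf.pos hloss),
    integral_densityMeasure hf.continuous hf.pos fun v => Real.log (condTensor f N v)]
  ring

section Limit

variable (hf : IsSqLogLipschitz K f) (hfE : IsUnitEnergyDensity f) (hpos : 0 < gaussianEntropy f)

include hf hfE hpos

theorem eventually_integral_log_condTensor_pos : ∀ᶠ N : ℕ in atTop,
    0 < ∫ v, Real.log (condTensor f N v) ∂(densityMeasure N (condTensor f N)) := by
  filter_upwards [(tendsto_integral_log_condTensor_div hf hfE).eventually_const_lt hpos,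
    eventually_ge_atTop 1] with N hN hN1
  exact (div_pos_iff_of_pos_right (Nat.cast_pos.mpr hN1)).mp hN

theorem eventually_entropy_condTensor_pos_and_lt_top : ∀ᶠ N : ℕ in atTop,
    0 < entropy N (condTensor f N) ∧ entropy N (condTensor f N) < ⊤ := by
  filter_upwards [eventually_integral_log_condTensor_pos hf hfE hpos, eventually_ge_atTop 1]
    with N hN hN1
  have : NeZero N := ⟨by omega⟩
  rw [entropy_condTensor hf.continuous hf.pos]
  exact ⟨ENNReal.ofReal_pos.mpr hN, ENNReal.ofReal_lt_top⟩

theorem tendsto_productionRatio_condTensor :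
    Tendsto (fun N => productionRatio N (condTensor f N)) atTop
      (𝓝 (((∫ z, meanCollisionLoss f z ∂(Measure.pi fun _ => lineMeasure f)) /
        gaussianEntropy f : ℝ) : EReal)) := by
  have hlim := (tendsto_integral_firstCoords_of_hasQuadraticGrowth hf hfE one_le_two
    (hasQuadraticGrowth_meanCollisionLoss hf)).div
      (tendsto_integral_log_condTensor_div hf hfE) hpos.ne'
  refine ((continuous_coe_real_ereal.tendsto _).comp hlim).congr' ?_
  filter_upwards [eventually_integral_log_condTensor_pos hf hfE hpos, eventually_ge_atTop 2]
    with N hN hN2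
  have : NeZero N := ⟨by omega⟩
  rw [productionRatio, entropy_condTensor hf.continuous hf.pos, entropyProduction_condTensor hf hN2,
    EReal.coe_ennreal_ofReal, max_eq_left hN.le, ← EReal.coe_div, Function.comp_apply,
    Pi.div_apply, div_div_eq_mul_div, mul_comm]

end Limit

end EntropyProduction

section GaussianCollisions

open ProbabilityTheory

variable {f : ℝ → ℝ} {K : ℝ≥0}

theorem IsSqLogLipschitz.integrable_log (hf : IsSqLogLipschitz K f) {μ : Measure ℝ}
    [IsFiniteMeasure μ] (hμ : Integrable (fun v => v ^ 2) μ) :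
    Integrable (fun v => Real.log (f v)) μ := by
  refine ((integrable_const |Real.log (f 0)|).add (hμ.const_mul (K : ℝ))).mono'
    hf.continuous_log.aestronglyMeasurable (ae_of_all _ fun v => ?_)
  have hlip := hf.abs_log_sub_log_le v 0
  rw [zero_pow two_ne_zero, sub_zero, abs_of_nonneg (sq_nonneg v)] at hlip
  have htri := abs_sub_abs_le_abs_sub (Real.log (f v)) (Real.log (f 0))
  simp only [Pi.add_apply, Real.norm_eq_abs]
  linarith

theorem integrable_sq_add_sq_prod {μ ν : Measure ℝ} [IsFiniteMeasure μ] [IsFiniteMeasure ν]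
    (hμ : Integrable (fun v => v ^ 2) μ) (hν : Integrable (fun v => v ^ 2) ν) :
    Integrable (fun z : ℝ × ℝ => z.1 ^ 2 + z.2 ^ 2) (μ.prod ν) :=
  (hμ.comp_fst ν).add (hν.comp_snd μ)

theorem integrable_collisionLoss (hf : IsSqLogLipschitz K f) {μ ν : Measure ℝ}
    [IsFiniteMeasure μ] [IsFiniteMeasure ν] (hμ : Integrable (fun v => v ^ 2) μ)
    (hν : Integrable (fun v => v ^ 2) ν) (θ : ℝ) :
    Integrable (fun z : ℝ × ℝ => collisionLoss f z.1 z.2 θ) (μ.prod ν) :=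
  ((integrable_sq_add_sq_prod hμ hν).const_mul (2 * K : ℝ)).mono'
    (continuous_collisionLoss_comp hf.continuous hf.pos continuous_fst continuous_snd
      continuous_const).aestronglyMeasurable
    (ae_of_all _ fun z => abs_collisionLoss_le hf z.1 z.2 θ)

theorem integrable_uncurry_collisionLoss (hf : IsSqLogLipschitz K f) {κ : Measure ℝ}
    {μ : Measure (ℝ × ℝ)} [IsFiniteMeasure κ] [IsFiniteMeasure μ]
    (hμ : Integrable (fun z : ℝ × ℝ => z.1 ^ 2 + z.2 ^ 2) μ) :
    Integrable (Function.uncurry fun (θ : ℝ) (z : ℝ × ℝ) => collisionLoss f z.1 z.2 θ)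
      (κ.prod μ) :=
  ((hμ.const_mul (2 * K : ℝ)).comp_snd κ).mono'
    (continuous_collisionLoss_comp hf.continuous hf.pos (by fun_prop) (by fun_prop)
      continuous_fst).aestronglyMeasurable
    (ae_of_all _ fun q => abs_collisionLoss_le hf q.2.1 q.2.2 q.1)

theorem integral_meanCollisionLoss_le (hf : IsSqLogLipschitz K f) {μ : Measure ℝ}
    [IsFiniteMeasure μ] (hμ : Integrable (fun v => v ^ 2) μ) {C : ℝ}
    (hC : ∀ θ, ∫ z : ℝ × ℝ, collisionLoss f z.1 z.2 θ ∂(μ.prod μ) ≤ C) :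
    ∫ z, meanCollisionLoss f z ∂(Measure.pi fun _ : Fin 2 => μ) ≤ C := by
  have hpi := Real.two_pi_pos
  have : IsFiniteMeasure (volume.restrict (Set.uIoc 0 (2 * Real.pi))) :=
    isFiniteMeasure_restrict.mpr measure_Ioc_lt_top.ne
  have hint := integrable_uncurry_collisionLoss (κ := volume.restrict (Set.uIoc 0 (2 * Real.pi)))
    hf (integrable_sq_add_sq_prod hμ hμ)
  have hprod : ∫ z, meanCollisionLoss f z ∂(Measure.pi fun _ : Fin 2 => μ) =
      ∫ z : ℝ × ℝ, (2 * Real.pi)⁻¹ * (∫ θ in (0 : ℝ)..(2 * Real.pi),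
        collisionLoss f z.1 z.2 θ) ∂(μ.prod μ) :=
    (measurePreserving_finTwoArrow μ).integral_comp' (f := MeasurableEquiv.finTwoArrow)
      fun z : ℝ × ℝ => (2 * Real.pi)⁻¹ * (∫ θ in (0 : ℝ)..(2 * Real.pi),
        collisionLoss f z.1 z.2 θ)
  rw [hprod, integral_const_mul, ← intervalIntegral_integral_swap hint, inv_mul_le_iff₀ hpi]
  calc ∫ θ in (0 : ℝ)..(2 * Real.pi), ∫ z : ℝ × ℝ, collisionLoss f z.1 z.2 θ ∂(μ.prod μ)
      ≤ ∫ _ in (0 : ℝ)..(2 * Real.pi), C :=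
        intervalIntegral.integral_mono_on hpi.le
          (intervalIntegrable_iff.mpr hint.integral_prod_left) intervalIntegrable_const
          fun θ _ => hC θ
    _ = 2 * Real.pi * C := by rw [intervalIntegral.integral_const, sub_zero, smul_eq_mul]

/-- Collisions inside one Gaussian population produce no entropy, as its law is invariant under
rotations. -/
theorem integral_collisionLoss_gaussianReal_prod_self (hf : IsSqLogLipschitz K f) (a : ℝ≥0)
    (θ : ℝ) : ∫ z : ℝ × ℝ, collisionLoss f z.1 z.2 θ
      ∂((gaussianReal 0 a).prod (gaussianReal 0 a)) = 0 := by
  set γ := (gaussianReal 0 a).prod (gaussianReal 0 a)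
  set l : ℝ × ℝ → ℝ := fun z => Real.log (f z.1) + Real.log (f z.2)
  have hlog := hf.integrable_log (integrable_pow_gaussianReal a 2)
  have hl : Integrable l γ := (hlog.comp_fst _).add (hlog.comp_snd _)
  have hrot : MeasurePreserving (ContinuousLinearMap.rotation θ : ℝ × ℝ →L[ℝ] ℝ × ℝ) γ γ :=
    ⟨by fun_prop, IsGaussian.map_rotation_eq_self (by simp) θ⟩
  have hl_rot_int : Integrable (fun z => l (ContinuousLinearMap.rotation θ z)) γ :=
    hrot.integrable_comp_of_integrable hl
  have hl_rot : ∫ z, l (ContinuousLinearMap.rotation θ z) ∂γ = ∫ z, l z ∂γ := by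
    rw [← integral_map hrot.measurable.aemeasurable (hrot.map_eq.symm ▸ hl.aestronglyMeasurable),
      hrot.map_eq]
  have hloss (z : ℝ × ℝ) : collisionLoss f z.1 z.2 θ = l z - l (ContinuousLinearMap.rotation θ z) :=
    sub_sub _ _ _
  simp only [hloss]
  rw [integral_sub hl hl_rot_int, hl_rot, sub_self]

end GaussianCollisions

section GaussianMixtures

open ProbabilityTheory

variable {p q : ℝ} {a b : ℝ≥0}

/-- The mixture, with weights `p` and `q`, of the centred Gaussian densities of variances `a` and
`b`. -/
def gaussianMix (p q : ℝ) (a b : ℝ≥0) (v : ℝ) : ℝ :=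
  p * gaussianPDFReal 0 a v + q * gaussianPDFReal 0 b v

theorem contDiff_gaussianPDFReal (a : ℝ≥0) : ContDiff ℝ ∞ (gaussianPDFReal 0 a) := by
  rw [gaussianPDFReal_def]
  fun_prop

theorem contDiff_gaussianMix (p q : ℝ) (a b : ℝ≥0) : ContDiff ℝ ∞ (gaussianMix p q a b) :=
  (contDiff_const.mul (contDiff_gaussianPDFReal a)).add
    (contDiff_const.mul (contDiff_gaussianPDFReal b))

theorem integrable_mul_gaussianMix (ha : a ≠ 0) (hb : b ≠ 0) {h : ℝ → ℝ}
    (hha : Integrable h (gaussianReal 0 a)) (hhb : Integrable h (gaussianReal 0 b)) :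
    Integrable fun v => h v * gaussianMix p q a b v := by
  rw [integrable_gaussianReal_iff ha] at hha
  rw [integrable_gaussianReal_iff hb] at hhb
  refine ((hha.const_mul p).add (hhb.const_mul q)).congr (ae_of_all _ fun v => ?_)
  simp only [gaussianMix, Pi.add_apply]
  ring

theorem integral_mul_gaussianMix (ha : a ≠ 0) (hb : b ≠ 0) {h : ℝ → ℝ}
    (hha : Integrable h (gaussianReal 0 a)) (hhb : Integrable h (gaussianReal 0 b)) :
    ∫ v, h v * gaussianMix p q a b v =
      p * ∫ v, h v ∂(gaussianReal 0 a) + q * ∫ v, h v ∂(gaussianReal 0 b) := by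
  rw [integrable_gaussianReal_iff ha] at hha
  rw [integrable_gaussianReal_iff hb] at hhb
  rw [integral_gaussianReal ha, integral_gaussianReal hb, ← integral_const_mul,
    ← integral_const_mul, ← integral_add (hha.const_mul p) (hhb.const_mul q)]
  refine integral_congr_ae (ae_of_all _ fun v => ?_)
  simp only [gaussianMix]
  ring

theorem gaussianPDFReal_le_one (ha : (1 : ℝ) / 2 ≤ a) (v : ℝ) : gaussianPDFReal 0 a v ≤ 1 := by
  have hsqrt : 1 ≤ √(2 * Real.pi * a) := by
    rw [Real.one_le_sqrt]
    nlinarith [Real.pi_gt_three]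
  rw [gaussianPDFReal]
  refine mul_le_one₀ (inv_le_one_of_one_le₀ hsqrt) (Real.exp_pos _).le
    (Real.exp_le_one_iff.mpr ?_)
  exact div_nonpos_of_nonpos_of_nonneg (neg_nonpos.mpr (sq_nonneg _)) (by positivity)

/-- The mixture `gaussianMix p q a b` is a probability density of second moment `1`. The bound
`1 / 2 ≤ a` makes it at most `1`, so that its logarithm is nonpositive. -/
structure IsUnitEnergyMixture (p q : ℝ) (a b : ℝ≥0) : Prop where
  left_weight_pos : 0 < p
  right_weight_pos : 0 < q
  weights_add : p + q = 1
  half_le_left : (1 : ℝ) / 2 ≤ a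
  left_le_right : a ≤ b
  energy : p * a + q * b = 1

namespace IsUnitEnergyMixture

variable (h : IsUnitEnergyMixture p q a b)

include h

theorem half_le_right : (1 : ℝ) / 2 ≤ b :=
  h.half_le_left.trans (NNReal.coe_le_coe.mpr h.left_le_right)

theorem left_pos : (0 : ℝ) < a := one_half_pos.trans_le h.half_le_left

theorem right_pos : (0 : ℝ) < b := one_half_pos.trans_le h.half_le_right

theorem left_ne_zero : a ≠ 0 := NNReal.coe_ne_zero.mp h.left_pos.ne'

theorem right_ne_zero : b ≠ 0 := NNReal.coe_ne_zero.mp h.right_pos.ne'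

theorem isSqLogLipschitz : IsSqLogLipschitz 1 (gaussianMix p q a b) := by
  have hcomponent {c : ℝ≥0} (hc : (1 : ℝ) / 2 ≤ c) (hc0 : c ≠ 0) :
      IsSqLogLipschitz 1 (gaussianPDFReal 0 c) := by
    refine (isSqLogLipschitz_gaussianPDFReal hc0).mono (inv_le_one_of_one_le₀ ?_)
    rw [← NNReal.coe_le_coe]
    push_cast
    linarith
  exact ((hcomponent h.half_le_left h.left_ne_zero).const_mul h.left_weight_pos).add
    ((hcomponent h.half_le_right h.right_ne_zero).const_mul h.right_weight_pos)

theorem integrable_abs_pow_mul (k : ℕ) : Integrable fun v => |v| ^ k * gaussianMix p q a b v :=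
  integrable_mul_gaussianMix h.left_ne_zero h.right_ne_zero
    (integrable_abs_pow_gaussianReal a k) (integrable_abs_pow_gaussianReal b k)

theorem isUnitEnergyDensity : IsUnitEnergyDensity (gaussianMix p q a b) where
  measurable := (contDiff_gaussianMix p q a b).continuous.measurable
  nonneg v := (h.isSqLogLipschitz.pos v).le
  integral_eq_one := by
    have hmass := integral_mul_gaussianMix (p := p) (q := q) h.left_ne_zero h.right_ne_zero
      (h := fun _ => 1) (integrable_const _) (integrable_const _)
    simpa only [one_mul, integral_const, probReal_univ, one_smul, mul_one, h.weights_add]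
      using hmass
  integral_sq_mul_eq_one := by
    rw [integral_mul_gaussianMix h.left_ne_zero h.right_ne_zero (integrable_pow_gaussianReal a 2)
      (integrable_pow_gaussianReal b 2), integral_sq_gaussianReal, integral_sq_gaussianReal,
      h.energy]
  integrable_pow_four_mul := integrable_mul_gaussianMix h.left_ne_zero h.right_ne_zero
    (integrable_pow_gaussianReal a 4) (integrable_pow_gaussianReal b 4)

theorem integral_mul_self : ∫ v, v * gaussianMix p q a b v = 0 := by
  have hint (c : ℝ≥0) : Integrable (fun v : ℝ => v) (gaussianReal 0 c) := by
    simpa only [pow_one] using integrable_pow_gaussianReal c 1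
  rw [integral_mul_gaussianMix h.left_ne_zero h.right_ne_zero (hint a) (hint b),
    integral_id_gaussianReal, integral_id_gaussianReal, mul_zero, mul_zero, add_zero]

theorem le_one (v : ℝ) : gaussianMix p q a b v ≤ 1 := by
  have ha := mul_le_mul_of_nonneg_left (gaussianPDFReal_le_one h.half_le_left v)
    h.left_weight_pos.le
  have hb := mul_le_mul_of_nonneg_left (gaussianPDFReal_le_one h.half_le_right v)
    h.right_weight_pos.le
  rw [gaussianMix]
  linarith [h.weights_add]

theorem log_nonpos (v : ℝ) : Real.log (gaussianMix p q a b v) ≤ 0 :=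
  Real.log_nonpos (h.isSqLogLipschitz.pos v).le (h.le_one v)

theorem le_log_left (v : ℝ) :
    Real.log p - Real.log (2 * Real.pi * a) / 2 - v ^ 2 / (2 * a) ≤
      Real.log (gaussianMix p q a b v) := by
  have ha := gaussianPDFReal_pos 0 a v h.left_ne_zero
  have hb := gaussianPDFReal_pos 0 b v h.right_ne_zero
  have hle := Real.log_le_log (mul_pos h.left_weight_pos ha)
    (le_add_of_nonneg_right (mul_pos h.right_weight_pos hb).le)
  rw [Real.log_mul h.left_weight_pos.ne' ha.ne', log_gaussianPDFReal h.left_ne_zero] at hle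
  rw [gaussianMix]
  linarith

theorem le_log_right (v : ℝ) :
    Real.log q - Real.log (2 * Real.pi * b) / 2 - v ^ 2 / (2 * b) ≤
      Real.log (gaussianMix p q a b v) := by
  have ha := gaussianPDFReal_pos 0 a v h.left_ne_zero
  have hb := gaussianPDFReal_pos 0 b v h.right_ne_zero
  have hle := Real.log_le_log (mul_pos h.right_weight_pos hb)
    (le_add_of_nonneg_left (mul_pos h.left_weight_pos ha).le)
  rw [Real.log_mul h.right_weight_pos.ne' hb.ne', log_gaussianPDFReal h.right_ne_zero] at hle
  rw [gaussianMix]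
  linarith

theorem integrable_log (c : ℝ≥0) :
    Integrable (fun v => Real.log (gaussianMix p q a b v)) (gaussianReal 0 c) :=
  h.isSqLogLipschitz.integrable_log (integrable_pow_gaussianReal c 2)

theorem sub_half_le_integral_log {c : ℝ≥0} (hc : c ≠ 0) {t : ℝ}
    (ht : ∀ v, t - v ^ 2 / (2 * c) ≤ Real.log (gaussianMix p q a b v)) :
    t - 1 / 2 ≤ ∫ v, Real.log (gaussianMix p q a b v) ∂(gaussianReal 0 c) := by
  have hsq := (integrable_pow_gaussianReal c 2).div_const (2 * (c : ℝ))
  calc t - 1 / 2 = ∫ v, (t - v ^ 2 / (2 * c)) ∂(gaussianReal 0 c) := by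
        rw [integral_sub (integrable_const t) hsq, integral_div, integral_sq_gaussianReal,
          integral_const, probReal_univ, one_smul]
        have hc' : (c : ℝ) ≠ 0 := NNReal.coe_ne_zero.mpr hc
        field_simp
    _ ≤ _ := integral_mono ((integrable_const t).sub hsq) (h.integrable_log c) ht

theorem le_gaussianEntropy :
    p * (Real.log p - Real.log (2 * Real.pi * a) / 2) +
        q * (Real.log q - Real.log (2 * Real.pi * b) / 2) + Real.log (2 * Real.pi) / 2 ≤
      gaussianEntropy (gaussianMix p q a b) := by
  rw [gaussianEntropy, h.isUnitEnergyDensity.integral_lineMeasure,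
    integral_mul_gaussianMix h.left_ne_zero h.right_ne_zero (h.integrable_log a)
      (h.integrable_log b)]
  have ha := mul_le_mul_of_nonneg_left
    (h.sub_half_le_integral_log h.left_ne_zero h.le_log_left) h.left_weight_pos.le
  have hb := mul_le_mul_of_nonneg_left
    (h.sub_half_le_integral_log h.right_ne_zero h.le_log_right) h.right_weight_pos.le
  linarith [h.weights_add]

theorem lineMeasure_eq : lineMeasure (gaussianMix p q a b) =
    ENNReal.ofReal p • gaussianReal 0 a + ENNReal.ofReal q • gaussianReal 0 b := by
  have hp := h.left_weight_pos.le
  have hq := h.right_weight_pos.le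
  rw [gaussianReal_of_var_ne_zero _ h.left_ne_zero, gaussianReal_of_var_ne_zero _ h.right_ne_zero,
    ← withDensity_smul _ (by fun_prop), ← withDensity_smul _ (by fun_prop),
    ← withDensity_add_left (by fun_prop), lineMeasure]
  congr 1
  funext v
  have ha := gaussianPDFReal_nonneg 0 a v
  have hb := gaussianPDFReal_nonneg 0 b v
  simp only [gaussianMix, Pi.add_apply, Pi.smul_apply, smul_eq_mul, gaussianPDF]
  rw [ENNReal.ofReal_add (by positivity) (by positivity), ENNReal.ofReal_mul hp,
    ENNReal.ofReal_mul hq]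

theorem collisionLoss_le (x y θ : ℝ) :
    collisionLoss (gaussianMix p q a b) x y θ ≤
      Real.log (2 * Real.pi * b) - 2 * Real.log q + (x ^ 2 + y ^ 2) / (2 * b) := by
  have hx' := h.le_log_right (Real.cos θ * x + Real.sin θ * y)
  have hy' := h.le_log_right (-Real.sin θ * x + Real.cos θ * y)
  rw [← sq_add_sq_rotate x y θ, add_div, collisionLoss]
  linarith [h.log_nonpos x, h.log_nonpos y]

theorem integral_collisionLoss_gaussianReal_prod_le {c d : ℝ≥0} (hcd : (c : ℝ) + d ≤ 2 * b)
    (θ : ℝ) : ∫ z : ℝ × ℝ, collisionLoss (gaussianMix p q a b) z.1 z.2 θ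
      ∂((gaussianReal 0 c).prod (gaussianReal 0 d)) ≤
      Real.log (2 * Real.pi * b) - 2 * Real.log q + 1 := by
  have hb := h.right_pos
  have hc := integrable_pow_gaussianReal c 2
  have hd := integrable_pow_gaussianReal d 2
  have hsq := (integrable_sq_add_sq_prod hc hd).div_const (2 * (b : ℝ))
  have henergy : ∫ z : ℝ × ℝ, (z.1 ^ 2 + z.2 ^ 2)
      ∂((gaussianReal 0 c).prod (gaussianReal 0 d)) = c + d := by
    rw [integral_add (hc.comp_fst _) (hd.comp_snd _), integral_fun_fst fun v : ℝ => v ^ 2,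
      integral_fun_snd fun v : ℝ => v ^ 2]
    simp only [probReal_univ, one_smul, integral_sq_gaussianReal]
  have hmono := integral_mono (integrable_collisionLoss h.isSqLogLipschitz hc hd θ)
    ((integrable_const _).add hsq) fun z => h.collisionLoss_le z.1 z.2 θ
  simp only [Pi.add_apply] at hmono
  rw [integral_add (integrable_const _) hsq, integral_div, henergy, integral_const,
    probReal_univ, one_smul] at hmono
  exact hmono.trans (add_le_add_right ((div_le_one (by positivity)).mpr hcd) _)

theorem integral_collisionLoss_le (θ : ℝ) :
    ∫ z : ℝ × ℝ, collisionLoss (gaussianMix p q a b) z.1 z.2 θ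
      ∂((lineMeasure (gaussianMix p q a b)).prod (lineMeasure (gaussianMix p q a b))) ≤
      2 * p * q * (Real.log (2 * Real.pi * b) - 2 * Real.log q + 1) := by
  have hp := h.left_weight_pos.le
  have hq := h.right_weight_pos.le
  have hab : (a : ℝ) ≤ b := NNReal.coe_le_coe.mpr h.left_le_right
  have hcross := h.integral_collisionLoss_gaussianReal_prod_le (c := a) (d := b)
    (by linarith) θ
  have hcross' := h.integral_collisionLoss_gaussianReal_prod_le (c := b) (d := a)
    (by linarith) θ
  have hint (c d : ℝ≥0) (s t : ℝ) : Integrable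
      (fun z : ℝ × ℝ => collisionLoss (gaussianMix p q a b) z.1 z.2 θ)
      (ENNReal.ofReal s • ENNReal.ofReal t • (gaussianReal 0 c).prod (gaussianReal 0 d)) :=
    ((integrable_collisionLoss h.isSqLogLipschitz (integrable_pow_gaussianReal c 2)
      (integrable_pow_gaussianReal d 2) θ).smul_measure ENNReal.ofReal_ne_top).smul_measure
      ENNReal.ofReal_ne_top
  rw [h.lineMeasure_eq, Measure.prod_add, Measure.add_prod, Measure.add_prod]
  simp only [Measure.prod_smul_left, Measure.prod_smul_right]
  rw [integral_add_measure ((hint _ _ _ _).add_measure (hint _ _ _ _))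
    ((hint _ _ _ _).add_measure (hint _ _ _ _)),
    integral_add_measure (hint _ _ _ _) (hint _ _ _ _),
    integral_add_measure (hint _ _ _ _) (hint _ _ _ _)]
  simp only [integral_smul_measure, ENNReal.toReal_ofReal hp, ENNReal.toReal_ofReal hq,
    smul_eq_mul, integral_collisionLoss_gaussianReal_prod_self h.isSqLogLipschitz, mul_zero,
    zero_add, add_zero]
  have hle := mul_le_mul_of_nonneg_left (add_le_add hcross hcross') (mul_nonneg hp hq)
  linarith

theorem integral_meanCollisionLoss_le :
    ∫ z, meanCollisionLoss (gaussianMix p q a b) z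
      ∂(Measure.pi fun _ => lineMeasure (gaussianMix p q a b)) ≤
      2 * p * q * (Real.log (2 * Real.pi * b) - 2 * Real.log q + 1) :=
  have := h.isUnitEnergyDensity.isProbabilityMeasure_lineMeasure
  KacModel.integral_meanCollisionLoss_le h.isSqLogLipschitz h.isUnitEnergyDensity.integrable_sq
    h.integral_collisionLoss_le

end IsUnitEnergyMixture

end GaussianMixtures

section Equipartition

variable {δ : ℝ}

/-- The two-temperature mixture in which the hot particles have weight `δ` and, like the cold ones,
carry half of the energy. -/
def equipartitionMix (δ : ℝ) : ℝ → ℝ :=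
  gaussianMix (1 - δ) δ (1 / (2 * (1 - δ))).toNNReal (1 / (2 * δ)).toNNReal

theorem isUnitEnergyMixture_equipartition (hδ : 0 < δ) (hδ' : δ ≤ 1 / 2) :
    IsUnitEnergyMixture (1 - δ) δ (1 / (2 * (1 - δ))).toNNReal (1 / (2 * δ)).toNNReal := by
  have hcold : 0 < 1 - δ := by linarith
  refine ⟨hcold, hδ, sub_add_cancel 1 δ, ?_, ?_, ?_⟩
  · rw [Real.coe_toNNReal _ (by positivity)]
    gcongr
    linarith
  · refine Real.toNNReal_le_toNNReal ?_
    gcongr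
    linarith
  · rw [Real.coe_toNNReal _ (by positivity), Real.coe_toNNReal _ (by positivity)]
    field_simp
    norm_num

theorem log_two_pi_mul_toNNReal {t : ℝ} (ht : 0 < t) :
    Real.log (2 * Real.pi * (1 / (2 * t)).toNNReal) = Real.log Real.pi - Real.log t := by
  rw [Real.coe_toNNReal _ (by positivity), ← Real.log_div Real.pi_ne_zero ht.ne']
  congr 1
  field_simp

theorem le_gaussianEntropy_equipartitionMix (hδ : 0 < δ) (hδ' : δ ≤ 1 / 2) :
    Real.log 2 / 2 - 3 / 2 * Real.binEntropy δ ≤ gaussianEntropy (equipartitionMix δ) := by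
  refine le_trans (le_of_eq ?_) (isUnitEnergyMixture_equipartition hδ hδ').le_gaussianEntropy
  rw [log_two_pi_mul_toNNReal hδ, log_two_pi_mul_toNNReal (by linarith : 0 < 1 - δ),
    Real.log_mul two_ne_zero Real.pi_ne_zero, Real.binEntropy, Real.log_inv, Real.log_inv]
  ring

theorem integral_meanCollisionLoss_equipartitionMix_le (hδ : 0 < δ) (hδ' : δ ≤ 1 / 2) :
    ∫ z, meanCollisionLoss (equipartitionMix δ) z
      ∂(Measure.pi fun _ => lineMeasure (equipartitionMix δ)) ≤
      2 * (1 - δ) * (δ * (Real.log Real.pi + 1) + 3 * Real.negMulLog δ) := by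
  refine (isUnitEnergyMixture_equipartition hδ hδ').integral_meanCollisionLoss_le.trans_eq ?_
  rw [log_two_pi_mul_toNNReal hδ, Real.negMulLog]
  ring

theorem exists_equipartitionMix_production_lt {c : ℝ} (hc : 0 < c) : ∃ δ : ℝ, 0 < δ ∧ δ ≤ 1 / 2 ∧
    0 < gaussianEntropy (equipartitionMix δ) ∧
    (∫ z, meanCollisionLoss (equipartitionMix δ) z
      ∂(Measure.pi fun _ => lineMeasure (equipartitionMix δ))) /
        gaussianEntropy (equipartitionMix δ) < c := by
  set u : ℝ → ℝ := fun δ => Real.log 2 / 2 - 3 / 2 * Real.binEntropy δ with hu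
  set w : ℝ → ℝ := fun δ => 2 * (1 - δ) * (δ * (Real.log Real.pi + 1) + 3 * Real.negMulLog δ)
    with hw
  have hu_cont : Continuous u := by fun_prop
  have hw_cont : Continuous w := by fun_prop
  have hu0 : 0 < u 0 := by
    simp only [hu, Real.binEntropy_zero, mul_zero, sub_zero]
    exact half_pos (Real.log_pos one_lt_two)
  have hw0 : w 0 < c * u 0 := by
    simp only [hw, Real.negMulLog_zero, mul_zero, zero_mul, add_zero]
    exact mul_pos hc hu0
  have hsmall : ∀ᶠ δ in 𝓝 (0 : ℝ), 0 < u δ ∧ w δ < c * u δ ∧ δ ≤ 1 / 2 :=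
    (hu_cont.continuousAt.eventually_const_lt hu0).and
      ((hw_cont.continuousAt.eventually_lt (hu_cont.const_mul c).continuousAt hw0).and
        (eventually_le_nhds one_half_pos))
  obtain ⟨δ, ⟨huδ, hwδ, hδ'⟩, hδ⟩ :=
    ((hsmall.filter_mono nhdsWithin_le_nhds).and self_mem_nhdsWithin).exists (f := 𝓝[>] 0)
  have hentropy := le_gaussianEntropy_equipartitionMix hδ hδ'
  have hpos : 0 < gaussianEntropy (equipartitionMix δ) := huδ.trans_le hentropy
  refine ⟨δ, hδ, hδ', hpos, (div_lt_iff₀ hpos).mpr ?_⟩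
  calc _ ≤ w δ := integral_meanCollisionLoss_equipartitionMix_le hδ hδ'
    _ < c * u δ := hwδ
    _ ≤ c * gaussianEntropy (equipartitionMix δ) := by gcongr

end Equipartition

theorem Gam_le_productionRatio {N : ℕ} {F : KacSphere N → ℝ} (hF : IsProbDensity N F)
    (hpos : 0 < entropy N F) (htop : entropy N F < ⊤) : Gam N ≤ productionRatio N F :=
  sInf_le ⟨F, hF, hpos.ne', htop.ne, rfl⟩

theorem eventually_Gam_lt {f : ℝ → ℝ} {K : ℝ≥0} (hf : IsSqLogLipschitz K f)
    (hfE : IsUnitEnergyDensity f) (hpos : 0 < gaussianEntropy f) {c : ℝ}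
    (hlt : (∫ z, meanCollisionLoss f z ∂(Measure.pi fun _ => lineMeasure f)) /
      gaussianEntropy f < c) :
    ∀ᶠ N : ℕ in atTop, Gam N < c := by
  filter_upwards [eventually_ge_atTop 1, eventually_entropy_condTensor_pos_and_lt_top hf hfE hpos,
    (tendsto_productionRatio_condTensor hf hfE hpos).eventually_lt_const
      (EReal.coe_lt_coe_iff.mpr hlt)] with N hN ⟨hN_pos, hN_top⟩ hN_lt
  have : NeZero N := ⟨by omega⟩
  have hprob := isProbDensity_condTensor (N := N) hf.continuous hf.pos
  exact (Gam_le_productionRatio hprob hN_pos hN_top).trans_lt hN_lt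

end KacModel

end

theorem mainTheorem1 :
    (∀ c : ℝ, 0 < c → ∃ f : ℝ → ℝ,
      -- `f` is a smooth bounded probability density on `ℝ` with moments of all orders,
      -- mean zero and unit variance
      (∀ v, 0 ≤ f v) ∧
      ContDiff ℝ ∞ f ∧
      (∃ C : ℝ, ∀ v, f v ≤ C) ∧
      (∀ k : ℕ, Integrable (fun v : ℝ => |v| ^ k * f v)) ∧
      (∫ v : ℝ, f v = 1) ∧
      (∫ v : ℝ, v * f v = 0) ∧
      (∫ v : ℝ, v ^ 2 * f v = 1) ∧
      -- the conditioned tensor products are probability densities and form a chaotic family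
      (∀ N : ℕ, 1 ≤ N → KacModel.IsProbDensity N (KacModel.condTensor f N)) ∧
      KacModel.IsChaotic (KacModel.lineMeasure f)
        (fun N => KacModel.densityMeasure N (KacModel.condTensor f N)) ∧
      -- the ratio is meaningful for all large `N`, and its limsup is at most `c`
      (∀ᶠ N : ℕ in atTop, 0 < KacModel.entropy N (KacModel.condTensor f N) ∧
        KacModel.entropy N (KacModel.condTensor f N) < ⊤) ∧
      limsup (fun N : ℕ => KacModel.productionRatio N (KacModel.condTensor f N)) atTop
        ≤ (c : EReal)) ∧
    -- no positive constant is a lower bound for `Γ_N`, even for all large `N` only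
    ¬ ∃ c : ℝ, 0 < c ∧ ∀ᶠ N : ℕ in atTop, (c : EReal) ≤ KacModel.Gam N := by
  refine ⟨fun c hc => ?_, ?_⟩
  · obtain ⟨δ, hδ, hδ', hpos, hlt⟩ := KacModel.exists_equipartitionMix_production_lt hc
    have hmix := KacModel.isUnitEnergyMixture_equipartition hδ hδ'
    have hf := hmix.isSqLogLipschitz
    have hfE := hmix.isUnitEnergyDensity
    exact ⟨KacModel.equipartitionMix δ, fun v => (hf.pos v).le,
      KacModel.contDiff_gaussianMix _ _ _ _, ⟨1, hmix.le_one⟩, hmix.integrable_abs_pow_mul,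
      hfE.integral_eq_one, hmix.integral_mul_self, hfE.integral_sq_mul_eq_one,
      fun N hN => have : NeZero N := ⟨by omega⟩
        KacModel.isProbDensity_condTensor hf.continuous hf.pos,
      KacModel.isChaotic_condTensor hf hfE,
      KacModel.eventually_entropy_condTensor_pos_and_lt_top hf hfE hpos,
      (KacModel.tendsto_productionRatio_condTensor hf hfE hpos).limsup_eq.trans_le
        (EReal.coe_le_coe_iff.mpr hlt.le)⟩
  · rintro ⟨c, hc, hGam⟩
    obtain ⟨δ, hδ, hδ', hpos, hlt⟩ := KacModel.exists_equipartitionMix_production_lt hc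
    have hmix := KacModel.isUnitEnergyMixture_equipartition hδ hδ'
    have hsmall := KacModel.eventually_Gam_lt hmix.isSqLogLipschitz hmix.isUnitEnergyDensity hpos
      hlt
    obtain ⟨N, hcN, hNc⟩ := (hGam.and hsmall).exists
    exact hcN.not_gt hNc
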